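/- Let $X$ be a finite set of actions, let $r_{obs}\sim\mathcal N(\mu,\Sigma)$ be a Gaussian random vector indexed by $X$ with $\Sigma_{x,x}\le 1$ for all $x\in X$, and let $r_{hid}$ be a random vector indexed by $X$ with finite expectation $\mathbb E[r_{hid}]$ that is independent of $r_{obs}$. Put $r(x):=r_{obs}(x)+r_{hid}(x)$ and let $x^*\in\arg\max_{x\in X} r(x)$ be a random maximizer. Let $x^*_{obs}\sim\mathbb P[x^*\mid r_{obs}]$, i.e. the conditional law of $x^*_{obs}$ given $(r_{obs},r_{hid})$ is the conditional law of $x^*$ given $r_{obs}$. In rounds $n=1,2,\dots$ an action $x_n\in X$ is chosen and $y_n:=r_{obs}(x_n)+\eta_n$ is observed, where $\eta_n\sim\mathcal N(0,\sigma_n^2)$, $0\le\sigma_n\le\sigma$ with $\sigma>0$, and $\eta_n$ is independent of $(r_{obs},r_{hid},x_1,y_1,\dots,x_{n-1},y_{n-1},x_n)$. With $\mathcal H_{n}:=(x_i,y_i)_{i=1}^{n}$, the actions follow Thompson sampling: $x_n\sim\mathbb P[x^*\mid\mathcal H_{n-1}]$, i.e. the conditional law of $x_n$ given $(r_{obs},r_{hid},\mathcal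 H_{n-1})$ is the conditional law of $x^*$ given $\mathcal H_{n-1}$. Let $\gamma_T:=\max_{z_1,\dots,z_T\in X} I\big(r_{obs};\,(r_{obs}(z_i)+\eta_i)_{i=1}^T\big)\in[0,\infty]$ be the maximum information gain ($I$ is mutual information in nats), $C_\sigma:=2/\ln(1+\sigma^{-2})$, $\beta:=1+\sqrt{2\log(2|X|)+2}$ and $\Delta:=\mathbb E[r(x^*)-r(x^*_{obs})]$. Then the expectations below and in the definition of $\Delta$ are finite, and for every $T\ge 0$ $$\mathbb E\Big[\sum_{n=1}^T \big(r(x^*)-r(x_n)\big)\Big]\;\le\;\beta\sqrt{C_\sigma\,T\,\gamma_T}+T\Delta .$$ (The right-hand side is read as $\infty$ if $T\ge1$ and $\gamma_T=\infty$, which can happen only if some $\sigma_n=0$ with $n\le T$.) -/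

import Mathlib

open MeasureTheory ProbabilityTheory
open scoped ENNReal NNReal

namespace HiddenRewardBandit

/-- The mutual information `I(U; V)` (in nats) of two random variables: the Kullback-Leibler
divergence of their joint law from the product of their marginal laws. -/
noncomputable def mutualInfo {Ω α β : Type*} [MeasurableSpace Ω] [MeasurableSpace α]
    [MeasurableSpace β] (P : Measure Ω) (U : Ω → α) (V : Ω → β) : ℝ≥0∞ :=
  InformationTheory.klDiv (P.map (fun ω => (U ω, V ω))) ((P.map U).prod (P.map V))

/-- The maximum information gain `γ_T = max_{z_1, …, z_T} I(r_obs; y_1, …, y_T)`, where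
`y_i = r_obs(z_i) + η_i` are noisy evaluations at fixed (deterministic) locations `z_i`.
The supremum is over the finite set of all location sequences of length `T`. -/
noncomputable def maxInfoGain {Ω X : Type*} [MeasurableSpace Ω] (P : Measure Ω)
    (robs : Ω → X → ℝ) (η : ℕ → Ω → ℝ) (T : ℕ) : ℝ≥0∞ :=
  ⨆ z : Fin T → X, mutualInfo P robs (fun ω (i : Fin T) => robs ω (z i) + η i ω)

/-- The observation `y_n = r_obs(x_n) + η_n`. -/
def obs {Ω X : Type*} (robs : Ω → X → ℝ) (η : ℕ → Ω → ℝ) (x : ℕ → Ω → X) (n : ℕ) (ω : Ω) : ℝ :=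
  robs ω (x n ω) + η n ω

/-- The history available when the action `x n` is chosen (rounds are numbered `0, 1, 2, …`):
all pairs `(x i, y i)` with `i < n`. -/
def hist {Ω X : Type*} (robs : Ω → X → ℝ) (η : ℕ → Ω → ℝ) (x : ℕ → Ω → X) (n : ℕ) (ω : Ω) :
    Fin n → X × ℝ :=
  fun i => (x i ω, obs robs η x i ω)

/-- `z ∼ ℙ[xs | H]`: the random action `z` is drawn from the conditional law of `xs` given `H`,
with randomness that is fresh relative to the random variable `G`, which comprises `H`.
That is, conditionally on `G`, the law of `z` is the conditional law of `xs` given `H`. -/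
def SampledFromPosterior {Ω X α β : Type*} [MeasurableSpace Ω] [MeasurableSpace α]
    [MeasurableSpace β] (P : Measure Ω) (z xs : Ω → X) (H : Ω → α) (G : Ω → β) : Prop :=
  ∀ a : X, P⟦z ⁻¹' {a} | MeasurableSpace.comap G inferInstance⟧
    =ᵐ[P] P⟦xs ⁻¹' {a} | MeasurableSpace.comap H inferInstance⟧

/-- Thompson sampling on a finite action set `X` for a reward `r = r_obs + r_hid` of which only
`r_obs` is (noisily) observed. -/
structure Setting {Ω X : Type*} [MeasurableSpace Ω] [Fintype X] [DecidableEq X]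
    [MeasurableSpace X] (P : Measure Ω)
    (m : EuclideanSpace ℝ X) (S : Matrix X X ℝ) (τ : ℕ → ℝ≥0) (σ : ℝ)
    (robs rhid : Ω → X → ℝ) (η : ℕ → Ω → ℝ) (xs xobs : Ω → X) (x : ℕ → Ω → X) : Prop where
  /-- All objects are random variables. -/
  measurable_robs : Measurable robs
  measurable_rhid : Measurable rhid
  measurable_η : ∀ n, Measurable (η n)
  measurable_xs : Measurable xs
  measurable_xobs : Measurable xobs
  measurable_x : ∀ n, Measurable (x n)
  /-- `S` is a covariance matrix, with variances at most one. -/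
  posSemidef : S.PosSemidef
  variance_le : ∀ a, S a a ≤ 1
  /-- `r_obs ∼ N(m, S)`. -/
  law_robs : P.map (fun ω => WithLp.toLp 2 (robs ω)) = multivariateGaussian m S
  /-- `r_hid` has finite expectation. -/
  integrable_rhid : ∀ a, Integrable (fun ω => rhid ω a) P
  /-- The hidden reward component is independent of the observable one. -/
  indep_rhid : IndepFun robs rhid P
  /-- `xs = argmax r`. -/
  isMax_xs : ∀ ω a, robs ω a + rhid ω a ≤ robs ω (xs ω) + rhid ω (xs ω)
  /-- `xobs ∼ ℙ[xs | r_obs]`. -/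
  sampled_xobs : SampledFromPosterior P xobs xs robs (fun ω => (robs ω, rhid ω))
  /-- `x n ∼ ℙ[xs | history before round n]`. -/
  sampled_x : ∀ n, SampledFromPosterior P (x n) xs (hist robs η x n)
    (fun ω => (robs ω, rhid ω, hist robs η x n ω))
  /-- `η n ∼ N(0, τ n ^ 2)` with `τ n ≤ σ`. -/
  law_η : ∀ n, P.map (η n) = gaussianReal 0 (τ n ^ 2)
  τ_le : ∀ n, (τ n : ℝ) ≤ σ
  /-- The noise of round `n` is independent of the rewards, of the history before round `n` and
  of the action of round `n`. -/
  indep_η : ∀ n, IndepFun (η n) (fun ω => (robs ω, rhid ω, hist robs η x n ω, x n ω)) P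

/-- `C_σ = 2 / ln(1 + σ⁻²)`. -/
noncomputable def Cσ (σ : ℝ) : ℝ := 2 / Real.log (1 + (σ ^ 2)⁻¹)

/-- `β = 1 + √(2 log(2 N) + 2)`, where `N` is the number of actions. -/
noncomputable def betaConst (N : ℕ) : ℝ := 1 + Real.sqrt (2 * Real.log (2 * N) + 2)

end HiddenRewardBandit

/-! The difficulty is adaptivity: the locations observed depend on earlier observations. It is
removed by working with fixed sequences z of locations. For fixed z the regression residual of
`robs` on the first n observations is a centred Gaussian vector independent of those observations.
It is also independent of the event that z is the sequence actually played, because given the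
rewards and the past each action is drawn with probabilities that depend on the history only, and on
that event the history is a function of z and the observations (`residual_spec`). Summing over the
finitely many prefixes transfers Gaussian estimates to the played path (`integral_adaptive_le`), so
no posterior law is ever constructed.

Let D and V be the residual and its variance along the played path. The prediction `robs` − D and V
are functions of the history, so Thompson sampling gives them the same expectation at `x n` and at
`xs`, while D has mean zero at `x n`. Hence the observable regret of a round is E[D(`xs`)]
(`integral_robs_sub`). The hidden reward is independent of both `x n` and `xobs`, which have the
same law, and `xobs` earns the same expected observable reward as `xs`; so the full regret of a
round is Δ + E[D(`xs`)] (`integral_reward_sub`).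

A bound uniform in the action, D² ≤ V·Q with E[Q] ≤ 2 log(2|X|) + 2, copes with the dependence of
`xs` on D. Together with E[V(`xs`)] = E[V(`x n`)] and Cauchy–Schwarz over outcomes and rounds, it
leaves the sum of E[V(`x n`)] to be estimated (`integral_residual_le`).

For every fixed z, concavity of the logarithm bounds each V by `Cσ σ` times ½ log(1 + V/σ²), and the
chain rule for relative entropy bounds the sum of these logarithms by the mutual information of
`robs` and the observations at z, hence by `maxInfoGain` (`sum_ofReal_log_le_mutualInfo`). Since
this holds for each z, it holds along the random path. -/

namespace HiddenRewardBandit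

/-! ### Independence and randomised choices -/

section Independence

variable {Ω α β γ : Type*} [MeasurableSpace Ω] [MeasurableSpace α] [MeasurableSpace β]
  [MeasurableSpace γ] {P : Measure Ω}

/-- The two hypotheses make the joint law of A, B and C a triple product, which can be re-bracketed.
-/
lemma indepFun_prodMk_of_indepFun_prodMk {A : Ω → α} {B : Ω → β} {C : Ω → γ}
    (hA : Measurable A) (hB : Measurable B) (hC : Measurable C) (hAB : IndepFun A B P)
    (hABC : IndepFun (fun ω => (A ω, B ω)) C P) [IsProbabilityMeasure P] :
    IndepFun A (fun ω => (B ω, C ω)) P := by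
  have : IsProbabilityMeasure (P.map A) := Measure.isProbabilityMeasure_map hA.aemeasurable
  have : IsProbabilityMeasure (P.map B) := Measure.isProbabilityMeasure_map hB.aemeasurable
  have : IsProbabilityMeasure (P.map C) := Measure.isProbabilityMeasure_map hC.aemeasurable
  have hBC : IndepFun B C P := hABC.comp measurable_snd measurable_id
  rw [indepFun_iff_map_prod_eq_prod_map_map (by fun_prop) (by fun_prop)] at hAB hABC hBC ⊢
  rw [hBC, ← Measure.prodAssoc_prod, ← hAB, ← hABC, Measure.map_map (by fun_prop) (by fun_prop)]
  rfl

/-- If the conditional probability of the event `E` given `G` is a function of `K`, and `V` is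
independent of `K`, then `V` is independent of `K` and `E` jointly. -/
lemma IndepFun.prodMk_indicator {V : Ω → α} {K : Ω → β} {G : Ω → γ} {E : Set Ω} {f : Ω → ℝ}
    (hG : Measurable G) (hVG : Measurable[MeasurableSpace.comap G inferInstance] V)
    (hKG : Measurable[MeasurableSpace.comap G inferInstance] K) (hE : MeasurableSet E)
    (hf : Measurable[MeasurableSpace.comap K inferInstance] f)
    (hEf : P⟦E | MeasurableSpace.comap G inferInstance⟧ =ᵐ[P] f)
    (hVK : IndepFun V K P) [IsProbabilityMeasure P] :
    IndepFun V (fun ω => (K ω, E.indicator (fun _ => (1 : ℝ)) ω)) P := by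
  have hGm : MeasurableSpace.comap G inferInstance ≤ (inferInstance : MeasurableSpace Ω) :=
    hG.comap_le
  have hV : Measurable V := hVG.mono hGm le_rfl
  have hK : Measurable K := hKG.mono hGm le_rfl
  have hfi : Integrable f P := integrable_condExp.congr hEf
  obtain ⟨φ, hφ, rfl⟩ := hf.exists_eq_measurable_comp
  -- The event on V and K is G-measurable, so this is the defining property of the conditional
  -- probability of E.
  have key1 : ∀ s : Set α, ∀ t : Set β, MeasurableSet s → MeasurableSet t →
      P.real (V ⁻¹' s ∩ K ⁻¹' t ∩ E) = ∫ ω in V ⁻¹' s ∩ K ⁻¹' t, φ (K ω) ∂P := by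
    intro s t hs ht
    have hm : MeasurableSet[MeasurableSpace.comap G inferInstance] (V ⁻¹' s ∩ K ⁻¹' t) :=
      (hVG hs).inter (hKG ht)
    have h1 := setIntegral_condExp hGm (f := E.indicator (fun _ => (1 : ℝ))) (μ := P)
      ((integrable_const _).indicator hE) hm
    rw [setIntegral_indicator hE] at h1
    simp only [integral_const, smul_eq_mul, mul_one, measureReal_restrict_apply_univ] at h1
    rw [← h1]
    exact setIntegral_congr_ae (hGm _ hm) (hEf.mono fun ω h _ => h)
  have key2 : ∀ s : Set α, ∀ t : Set β, MeasurableSet s → MeasurableSet t →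
      P.real (V ⁻¹' s ∩ K ⁻¹' t ∩ E) = P.real (V ⁻¹' s) * P.real (K ⁻¹' t ∩ E) := by
    intro s t hs ht
    have h2 := key1 Set.univ t MeasurableSet.univ ht
    simp only [Set.preimage_univ, Set.univ_inter] at h2
    rw [key1 s t hs ht, h2, ← integral_indicator ((hV hs).inter (hK ht)),
      ← integral_indicator (hK ht)]
    have h3 : IndepFun (fun ω => s.indicator (fun _ => (1 : ℝ)) (V ω))
        (fun ω => t.indicator φ (K ω)) P :=
      hVK.comp (φ := fun v => s.indicator (fun _ => (1 : ℝ)) v) (ψ := t.indicator φ)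
        (measurable_const.indicator hs) (hφ.indicator ht)
    have h4 := h3.integral_fun_mul_eq_mul_integral
      (((measurable_const.indicator hs).comp hV).aestronglyMeasurable)
      (((hφ.indicator ht).comp hK).aestronglyMeasurable)
    have h5 : ∫ ω, s.indicator (fun _ => (1 : ℝ)) (V ω) ∂P = P.real (V ⁻¹' s) := by
      rw [← integral_indicator_one (hV hs)]; rfl
    rw [h5] at h4
    calc _ = ∫ ω, s.indicator (fun _ => (1 : ℝ)) (V ω) * t.indicator φ (K ω) ∂P := by
          congr 1; ext ω
          by_cases h1 : V ω ∈ s <;> by_cases h2 : K ω ∈ t <;> simp [h1, h2]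
      _ = _ := h4
      _ = _ := by rfl
  have key3 : ∀ s : Set α, ∀ t : Set β, MeasurableSet s → MeasurableSet t →
      P.real (V ⁻¹' s ∩ (K ⁻¹' t ∩ Eᶜ)) = P.real (V ⁻¹' s) * P.real (K ⁻¹' t ∩ Eᶜ) := by
    intro s t hs ht
    have h1 := measureReal_inter_add_sdiff (μ := P) (s := V ⁻¹' s ∩ K ⁻¹' t) hE
    have h2 := measureReal_inter_add_sdiff (μ := P) (s := K ⁻¹' t) hE
    have h3 : P.real (V ⁻¹' s ∩ K ⁻¹' t) = P.real (V ⁻¹' s) * P.real (K ⁻¹' t) := by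
      simp only [measureReal_def, hVK.measure_inter_preimage_eq_mul s t hs ht, ENNReal.toReal_mul]
    rw [key2 s t hs ht] at h1
    rw [Set.sdiff_eq] at h1 h2
    rw [← Set.inter_assoc]
    linear_combination h1 + h3 - P.real (V ⁻¹' s) * h2
  rw [indepFun_iff_measure_inter_preimage_eq_mul]
  intro s C hs hC
  -- The indicator takes only the values 1 and 0, so a measurable set of pairs matters only through
  -- its two slices.
  have hC1 : MeasurableSet ((fun b : β => (b, (1 : ℝ))) ⁻¹' C) := measurable_prodMk_right hC
  have hC0 : MeasurableSet ((fun b : β => (b, (0 : ℝ))) ⁻¹' C) := measurable_prodMk_right hC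
  set t1 := (fun b : β => (b, (1 : ℝ))) ⁻¹' C
  set t0 := (fun b : β => (b, (0 : ℝ))) ⁻¹' C
  have hsplit : (fun ω => (K ω, E.indicator (fun _ => (1 : ℝ)) ω)) ⁻¹' C =
      (K ⁻¹' t1 ∩ E) ∪ (K ⁻¹' t0 ∩ Eᶜ) := by
    ext ω
    by_cases h : ω ∈ E <;> simp [h, t1, t0]
  have hdis : Disjoint (K ⁻¹' t1 ∩ E) (K ⁻¹' t0 ∩ Eᶜ) :=
    Set.disjoint_left.2 fun ω h1 h2 => h2.2 h1.2
  have hm0 : MeasurableSet (K ⁻¹' t0 ∩ Eᶜ) := (hK hC0).inter hE.compl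
  rw [← ENNReal.toReal_eq_toReal_iff' (by finiteness) (by finiteness), ENNReal.toReal_mul]
  change P.real _ = P.real _ * P.real _
  rw [hsplit, Set.inter_union_distrib_left, measureReal_union
    (hdis.mono Set.inter_subset_right Set.inter_subset_right) ((hV hs).inter hm0),
    measureReal_union hdis hm0, key3 s t0 hs hC0, ← Set.inter_assoc, key2 s t1 hs hC1]
  ring

end Independence

/-! ### Relative entropy and a single Gaussian observation -/

section KullbackLeibler

open InformationTheory Real

/-- The lower bound in the Donsker-Varadhan variational formula. -/
lemma ofReal_integral_le_klDiv {α : Type*} [MeasurableSpace α] {μ ν : Measure α}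
    [IsProbabilityMeasure μ] [IsProbabilityMeasure ν] {f : α → ℝ} (hf : Integrable f μ)
    (hexp : Integrable (fun x => exp (f x)) ν) (hle : ∫ x, exp (f x) ∂ν ≤ 1) :
    ENNReal.ofReal (∫ x, f x ∂μ) ≤ klDiv μ ν := by
  by_cases htop : klDiv μ ν = ∞
  · simp [htop]
  obtain ⟨hac, hint⟩ := klDiv_ne_top_iff.1 htop
  -- Gibbs' inequality for the tilted measure: KL(μ ‖ ν tilted by f) = KL(μ ‖ ν) − ∫ f dμ + log ∫
  -- exp f dν is nonnegative.
  have := isProbabilityMeasure_tilted hexp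
  have hac' : μ ≪ ν.tilted f := hac.trans (absolutelyContinuous_tilted hexp)
  have h1 := integral_llr_add_sub_measure_univ_nonneg hac'
    (integrable_llr_tilted_right hac hf hint hexp)
  rw [integral_llr_tilted_right hac hf hexp hint] at h1
  have h2 : log (∫ x, exp (f x) ∂ν) ≤ 0 := log_nonpos (integral_exp_pos hexp).le hle
  rw [← ENNReal.ofReal_toReal htop, toReal_klDiv hac hint]
  apply ENNReal.ofReal_le_ofReal
  simp only [probReal_univ] at h1 ⊢
  linarith

/-- Complete the square in u around v s / (q + v): up to normalisation this convolves Gaussian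
densities of variances q and v. -/
lemma integral_exp_neg_sub_sq_gaussianReal {v : ℝ≥0} (hv : v ≠ 0) {q : ℝ} (hq : 0 < q) (s : ℝ) :
    ∫ u, exp (-(s - u) ^ 2 / (2 * q)) ∂(gaussianReal 0 v) =
      √(q / (q + v)) * exp (-s ^ 2 / (2 * (q + v))) := by
  have hv' : (0 : ℝ) < v := by positivity
  rw [integral_gaussianReal_eq_integral_smul hv]
  have h1 : ∀ u : ℝ, gaussianPDFReal 0 v u • exp (-(s - u) ^ 2 / (2 * q)) =
      ((√(2 * π * v))⁻¹ * exp (-s ^ 2 / (2 * (q + v)))) *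
        exp (-((q + v) / (2 * q * v)) * (u - v * s / (q + v)) ^ 2) := by
    intro u
    rw [gaussianPDFReal, smul_eq_mul, mul_assoc _ (exp _) (exp _), mul_assoc _ (exp _) (exp _),
      ← exp_add, ← exp_add]
    congr 2
    field_simp
    ring
  simp_rw [h1]
  rw [integral_const_mul, integral_sub_right_eq_self
    (fun u => exp (-((q + v) / (2 * q * v)) * u ^ 2)), integral_gaussian, mul_right_comm]
  congr 1
  rw [← sqrt_inv, ← sqrt_mul (by positivity)]
  congr 1
  field_simp

/-- A lower bound on the information that a noisy observation of a Gaussian variable yields. -/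
lemma ofReal_log_le_mutualInfo {Ω : Type*} [MeasurableSpace Ω] {P : Measure Ω}
    [IsProbabilityMeasure P] {u e : Ω → ℝ} {v w : ℝ≥0} (hu : Measurable u) (he : Measurable e)
    (hue : IndepFun u e P) (hlu : P.map u = gaussianReal 0 v) (hle : P.map e = gaussianReal 0 w)
    {q : ℝ} (hq : 0 < q) (hwq : (w : ℝ) ≤ q) :
    ENNReal.ofReal (1 / 2 * log (1 + q⁻¹ * v)) ≤ mutualInfo P u (fun ω => u ω + e ω) := by
  rcases eq_or_ne v 0 with rfl | hv
  · simp
  have hv' : (0 : ℝ) < v := by positivity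
  have hls : P.map (fun ω => u ω + e ω) = gaussianReal 0 (v + w) := by
    have := gaussianReal_add_gaussianReal_of_indepFun hue hlu hle
    simpa [Pi.add_def] using this
  -- The log-likelihood ratio of joint law to product law if the noise had variance exactly q. Using
  -- q in place of w keeps it meaningful when w = 0, where there is no noise density.
  set f : ℝ × ℝ → ℝ := fun p => 1 / 2 * log (1 + q⁻¹ * v) - (p.2 - p.1) ^ 2 / (2 * q)
    + p.2 ^ 2 / (2 * (q + v)) with hf
  have hfm : Measurable f := by fun_prop
  have hμ : IsProbabilityMeasure (P.map (fun ω => (u ω, u ω + e ω))) :=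
    Measure.isProbabilityMeasure_map (by fun_prop)
  have sq_int : ∀ {X : Ω → ℝ} {t : ℝ≥0}, Measurable X → P.map X = gaussianReal 0 t →
      Integrable (fun ω => X ω ^ 2) P ∧ ∫ ω, X ω ^ 2 ∂P = t := by
    intro X t hX hXl
    have hi : Integrable (fun y : ℝ => y ^ 2) (gaussianReal 0 t) := by
      simpa using! (memLp_id_gaussianReal' (μ := 0) (v := t) 2 (by simp)).integrable_sq
    refine ⟨?_, ?_⟩
    · rw [← hXl] at hi
      exact hi.comp_measurable hX
    · have := variance_fun_id_gaussianReal (μ := 0) (v := t)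
      rw [variance_of_integral_eq_zero (by fun_prop) (by simp)] at this
      rw [← this, ← hXl, integral_map (by fun_prop) (by fun_prop)]
  obtain ⟨hie, hiev⟩ := sq_int he hle
  obtain ⟨his, hisv⟩ : Integrable (fun ω => (u ω + e ω) ^ 2) P ∧
      ∫ ω, (u ω + e ω) ^ 2 ∂P = (v + w : ℝ≥0) := sq_int (hu.add he) hls
  have hfe : ∀ ω, f (u ω, u ω + e ω) = 1 / 2 * log (1 + q⁻¹ * v) - e ω ^ 2 / (2 * q)
      + (u ω + e ω) ^ 2 / (2 * (q + v)) := by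
    intro ω; simp [hf]
  have hfP : Integrable (fun ω => f (u ω, u ω + e ω)) P := by
    simp_rw [hfe]
    exact ((integrable_const _).sub (hie.div_const _)).add (his.div_const _)
  have hfint : Integrable f (P.map (fun ω => (u ω, u ω + e ω))) :=
    (integrable_map_measure hfm.aestronglyMeasurable (by fun_prop)).2 hfP
  have hexp : ∀ p : ℝ × ℝ, exp (f p) = √(1 + q⁻¹ * v) * exp (p.2 ^ 2 / (2 * (q + v))) *
      exp (-(p.2 - p.1) ^ 2 / (2 * q)) := by
    intro p
    have h1 : √(1 + q⁻¹ * v) = exp (1 / 2 * log (1 + q⁻¹ * v)) := by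
      rw [sqrt_eq_rpow, rpow_def_of_pos (by positivity), mul_comm]
    rw [h1, ← exp_add, ← exp_add]
    congr 1
    simp only [hf]
    ring
  -- The normalisation holds for each s separately, so the true marginal law of the observation, of
  -- variance v + w, does no harm.
  have hinner : ∀ s : ℝ, ∫ r, exp (f (r, s)) ∂(gaussianReal 0 v) = 1 := by
    intro s
    simp_rw [hexp]
    rw [integral_const_mul, integral_exp_neg_sub_sq_gaussianReal hv hq]
    have h1 : √(1 + q⁻¹ * v) * √(q / (q + v)) = 1 := by
      rw [← sqrt_mul (by positivity)]
      rw [show (1 + q⁻¹ * (v : ℝ)) * (q / (q + v)) = 1 by field_simp]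
      simp
    have h2 : exp (s ^ 2 / (2 * (q + v))) * exp (-s ^ 2 / (2 * (q + v))) = 1 := by
      rw [← exp_add]; simp [neg_div]
    linear_combination h1 * (exp (s ^ 2 / (2 * (q + v))) * exp (-s ^ 2 / (2 * (q + v)))) + h2
  have hexpi : Integrable (fun p => exp (f p)) ((gaussianReal 0 v).prod (gaussianReal 0 (v + w))) := by
    rw [integrable_prod_iff' (by fun_prop)]
    refine ⟨.of_forall fun s => ?_, ?_⟩
    -- A non-integrable function has Bochner integral 0, so the value 1 already proves
    -- integrability.
    · exact Integrable.of_integral_ne_zero (by rw [hinner]; simp)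
    · simp only [norm_eq_abs, abs_exp, hinner]
      exact integrable_const _
  rw [mutualInfo, hlu, hls]
  refine le_trans (ENNReal.ofReal_le_ofReal ?_) (ofReal_integral_le_klDiv hfint hexpi ?_)
  · rw [integral_map (by fun_prop) (by fun_prop)]
    simp_rw [hfe]
    rw [integral_add (f := fun ω => 1 / 2 * log (1 + q⁻¹ * v) - e ω ^ 2 / (2 * q))
      ((integrable_const _).sub (hie.div_const _)) (his.div_const _),
      integral_sub (integrable_const _) (hie.div_const _), integral_div, integral_div, hiev, hisv]
    simp only [integral_const, probReal_univ, smul_eq_mul, one_mul]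
    -- The quadratic terms of f contribute a nonnegative amount in expectation exactly because w ≤
    -- q.
    have : (w : ℝ) / (2 * q) ≤ ((v + w : ℝ≥0) : ℝ) / (2 * (q + v)) := by
      rw [div_le_div_iff₀ (by positivity) (by positivity)]
      push_cast
      nlinarith
    linarith
  · rw [integral_prod_symm _ hexpi]
    simp [hinner]

end KullbackLeibler

/-! ### Data processing and the chain rule for mutual information -/

section MutualInformation

open InformationTheory

variable {Ω α β γ : Type*} [MeasurableSpace Ω] [MeasurableSpace α] [MeasurableSpace β]
  [MeasurableSpace γ] {P : Measure Ω} [IsProbabilityMeasure P]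

lemma mutualInfo_comp_le {U : Ω → α} {W : Ω → β} {f : β → γ} (hU : Measurable U)
    (hW : Measurable W) (hf : Measurable f) :
    mutualInfo P U (fun ω => f (W ω)) ≤ mutualInfo P U W := by
  have : IsProbabilityMeasure (P.map U) := Measure.isProbabilityMeasure_map hU.aemeasurable
  have : IsProbabilityMeasure (P.map W) := Measure.isProbabilityMeasure_map hW.aemeasurable
  have h := klDiv_map_le (μ := P.map (fun ω => (U ω, W ω))) (ν := (P.map U).prod (P.map W))
    (g := Prod.map id f) (by fun_prop)
  rw [Measure.map_map (by fun_prop) (by fun_prop),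
    ← Measure.map_prod_map _ _ measurable_id hf, Measure.map_id, Measure.map_map hf hW] at h
  exact h

/-- The Markov kernel that adds `f z` to a random variable of law `ρ`. -/
noncomputable def shiftKernel (f : α → ℝ) (ρ : Measure ℝ) : Kernel α ℝ :=
  (Kernel.id ×ₖ Kernel.const α ρ).map (fun p => f p.1 + p.2)

lemma isMarkovKernel_shiftKernel {f : α → ℝ} (hf : Measurable f) (ρ : Measure ℝ)
    [IsProbabilityMeasure ρ] : IsMarkovKernel (shiftKernel f ρ) :=
  Kernel.IsMarkovKernel.map _ (by fun_prop)

lemma compProd_shiftKernel (μ : Measure α) [SFinite μ] {f : α → ℝ} (hf : Measurable f)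
    (ρ : Measure ℝ) [IsProbabilityMeasure ρ] :
    μ ⊗ₘ shiftKernel f ρ = (μ.prod ρ).map (fun p => (p.1, f p.1 + p.2)) := by
  have := isMarkovKernel_shiftKernel hf ρ
  ext s hs
  rw [Measure.compProd_apply hs, Measure.map_apply (by fun_prop) hs,
    Measure.prod_apply ((by fun_prop : Measurable fun p : α × ℝ => (p.1, f p.1 + p.2)) hs)]
  refine lintegral_congr fun z => ?_
  rw [shiftKernel, Kernel.map_apply' _ (by fun_prop) _ (measurable_prodMk_left hs),
    Kernel.prod_apply, Kernel.id_apply, Kernel.const_apply, Measure.dirac_prod,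
    Measure.map_apply (by fun_prop)
      ((by fun_prop : Measurable fun p : α × ℝ => f p.1 + p.2) (measurable_prodMk_left hs))]
  rfl

/-- One step of the chain rule: a noisy observation `φ (U) + e` yields, in addition to an earlier
observation `Y`, at least the information that it contains about the residual `φ (U) - g (Y)`. -/
lemma mutualInfo_add_le {U : Ω → α} {Y : Ω → β} {e : Ω → ℝ} {φ : α → ℝ} {g : β → ℝ}
    (hU : Measurable U) (hY : Measurable Y) (he : Measurable e) (hφ : Measurable φ)
    (hg : Measurable g) (hind : IndepFun (fun ω => (U ω, Y ω)) e P)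
    (hres : IndepFun (fun ω => φ (U ω) - g (Y ω)) Y P) :
    mutualInfo P U Y + mutualInfo P (fun ω => φ (U ω) - g (Y ω))
        (fun ω => φ (U ω) - g (Y ω) + e ω)
      ≤ mutualInfo P U (fun ω => (Y ω, φ (U ω) + e ω)) := by
  set u : Ω → ℝ := fun ω => φ (U ω) - g (Y ω) with hu
  have hum : Measurable u := by fun_prop
  have : IsProbabilityMeasure (P.map U) := Measure.isProbabilityMeasure_map hU.aemeasurable
  have : IsProbabilityMeasure (P.map Y) := Measure.isProbabilityMeasure_map hY.aemeasurable
  have : IsProbabilityMeasure (P.map e) := Measure.isProbabilityMeasure_map he.aemeasurable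
  have : IsProbabilityMeasure (P.map (fun ω => u ω + e ω)) :=
    Measure.isProbabilityMeasure_map (by fun_prop)
  have : IsProbabilityMeasure (P.map (fun ω => (U ω, Y ω))) :=
    Measure.isProbabilityMeasure_map (by fun_prop)
  have : IsProbabilityMeasure (P.map (fun ω => (Y ω, φ (U ω) + e ω))) :=
    Measure.isProbabilityMeasure_map (by fun_prop)
  have hYe : IndepFun Y (fun ω => u ω + e ω) P := by
    have h1 : IndepFun (fun ω => (Y ω, u ω)) e P :=
      hind.comp (φ := fun p : α × β => (p.2, φ p.1 - g p.2)) (ψ := id) (by fun_prop) measurable_id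
    exact (indepFun_prodMk_of_indepFun_prodMk hY hum he hres.symm h1).comp
      (φ := id) (ψ := fun p : ℝ × ℝ => p.1 + p.2) measurable_id (by fun_prop)
  have hue : IndepFun u e P :=
    hind.comp (φ := fun p : α × β => φ p.1 - g p.2) (ψ := id) (by fun_prop) measurable_id
  set μ := P.map (fun ω => (U ω, Y ω)) with hμ
  set ν := (P.map U).prod (P.map Y) with hν
  have hf1 : Measurable fun p : α × β => φ p.1 := by fun_prop
  have hf2 : Measurable fun p : α × β => g p.2 := by fun_prop
  -- κ₁ is the conditional law of the new observation given (U, Y). κ₂ is its conditional law given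
  -- Y alone, since the observation equals g(Y) plus a variable independent of Y. Thus ν ⊗ κ₂ is, up
  -- to bracketing, the product of the law of U and that of all observations.
  set κ₁ := shiftKernel (fun p : α × β => φ p.1) (P.map e) with hκ₁
  set κ₂ := shiftKernel (fun p : α × β => g p.2) (P.map (fun ω => u ω + e ω)) with hκ₂
  have := isMarkovKernel_shiftKernel hf1 (P.map e)
  have := isMarkovKernel_shiftKernel hf2 (P.map (fun ω => u ω + e ω))
  have hchain := klDiv_compProd_eq_add (μ := μ) (ν := ν) (κ := κ₁) (η := κ₂)
  have hμκ₁ : μ ⊗ₘ κ₁ = P.map (fun ω => ((U ω, Y ω), φ (U ω) + e ω)) := by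
    rw [compProd_shiftKernel μ hf1, hμ,
      ← (indepFun_iff_map_prod_eq_prod_map_map (by fun_prop) (by fun_prop)).1 hind,
      Measure.map_map (by fun_prop) (by fun_prop)]
    rfl
  have hνκ₂ : ν ⊗ₘ κ₂ = ((P.map U).prod (P.map (fun ω => (Y ω, φ (U ω) + e ω)))).map
      (fun p => ((p.1, p.2.1), p.2.2)) := by
    have h1 : P.map (fun ω => (Y ω, φ (U ω) + e ω)) =
        ((P.map Y).prod (P.map (fun ω => u ω + e ω))).map (fun p => (p.1, g p.1 + p.2)) := by
      rw [← (indepFun_iff_map_prod_eq_prod_map_map (by fun_prop) (by fun_prop)).1 hYe,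
        Measure.map_map (by fun_prop) (by fun_prop)]
      congr 1
      ext ω <;> simp [hu]
      ring
    rw [compProd_shiftKernel ν hf2, hν, h1]
    conv_rhs => rw [← Measure.map_id (μ := P.map U)]
    rw [Measure.map_prod_map _ _ measurable_id (by fun_prop), ← Measure.prodAssoc_prod,
      Measure.map_map (by fun_prop) (by fun_prop), Measure.map_map (by fun_prop) (by fun_prop)]
    rfl
  have hμκ₂ : μ ⊗ₘ κ₂ = (μ.prod (P.map (fun ω => u ω + e ω))).map
      (fun p => (p.1, g p.1.2 + p.2)) := compProd_shiftKernel μ hf2 _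
  have hdp1 : klDiv (μ ⊗ₘ κ₁) (ν ⊗ₘ κ₂) ≤ mutualInfo P U (fun ω => (Y ω, φ (U ω) + e ω)) := by
    have h := klDiv_map_le (μ := P.map (fun ω => (U ω, (Y ω, φ (U ω) + e ω))))
      (ν := (P.map U).prod (P.map (fun ω => (Y ω, φ (U ω) + e ω))))
      (g := fun p : α × β × ℝ => ((p.1, p.2.1), p.2.2)) (by fun_prop)
    rw [Measure.map_map (by fun_prop) (by fun_prop)] at h
    rw [hμκ₁, hνκ₂]
    exact h
  -- Subtracting the prediction g(Y) maps the two measures to the joint law of u and u + e and to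
  -- the product of their laws; data processing does the rest.
  have hdp2 : mutualInfo P u (fun ω => u ω + e ω) ≤ klDiv (μ ⊗ₘ κ₁) (μ ⊗ₘ κ₂) := by
    have h := klDiv_map_le (μ := μ ⊗ₘ κ₁) (ν := μ ⊗ₘ κ₂)
      (g := fun p : (α × β) × ℝ => (φ p.1.1 - g p.1.2, p.2 - g p.1.2)) (by fun_prop)
    refine le_of_eq_of_le ?_ h
    rw [mutualInfo, hμκ₁, hμκ₂, Measure.map_map (by fun_prop) (by fun_prop),
      Measure.map_map (by fun_prop) (by fun_prop)]
    congr 1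
    · congr 1
      ext ω <;> simp [hu]
      ring
    · rw [show P.map u = μ.map (fun p : α × β => φ p.1 - g p.2) by
        rw [hμ, Measure.map_map (by fun_prop) (by fun_prop)]; rfl]
      conv_lhs => rw [← Measure.map_id (μ := P.map (fun ω => u ω + e ω))]
      rw [Measure.map_prod_map _ _ (by fun_prop) measurable_id]
      congr 1
      ext p <;> simp
  calc _ ≤ klDiv μ ν + klDiv (μ ⊗ₘ κ₁) (μ ⊗ₘ κ₂) := add_le_add le_rfl hdp2
    _ = klDiv (μ ⊗ₘ κ₁) (ν ⊗ₘ κ₂) := hchain.symm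
    _ ≤ _ := hdp1

end MutualInformation

/-! ### Expected excess of a squared Gaussian over a level -/

section GaussianTail

open Real

/-- Integrate the two-sided sub-Gaussian tail 2 exp(−(A + t)/2) over t > 0; the integration supplies
the second factor 2. -/
lemma integral_max_sq_sub_gaussianReal_le {A : ℝ} (hA : 0 ≤ A) :
    ∫ z, max (z ^ 2 - A) 0 ∂(gaussianReal 0 1) ≤ 4 * exp (-A / 2) := by
  have hsq : Integrable (fun y : ℝ => y ^ 2) (gaussianReal 0 1) := by
    simpa using! (memLp_id_gaussianReal' (μ := 0) (v := 1) 2 (by simp)).integrable_sq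
  have hint : Integrable (fun z : ℝ => max (z ^ 2 - A) 0) (gaussianReal 0 1) :=
    (hsq.sub (integrable_const A)).pos_part
  rw [hint.integral_eq_integral_meas_lt (.of_forall fun z => le_max_right _ _)]
  have hsub : ∀ s : ℝ, (s = 1 ∨ s = -1) →
      HasSubgaussianMGF (fun z : ℝ => s * z) 1 (gaussianReal 0 1) := by
    intro s hs
    refine ⟨fun t => ?_, fun t => ?_⟩
    · simp_rw [← mul_assoc]
      exact integrable_exp_mul_gaussianReal (t * s)
    · have h1 : (gaussianReal 0 1).map (fun z : ℝ => s * z) = gaussianReal 0 1 := by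
        rw [gaussianReal_map_const_mul]
        congr 1
        · simp
        · ext; rcases hs with rfl | rfl <;> simp
      rw [mgf_gaussianReal h1]
      simp
  have htail : ∀ t : ℝ, 0 < t →
      (gaussianReal 0 1).real {z | t < max (z ^ 2 - A) 0} ≤ 2 * exp (-(A + t) / 2) := by
    intro t ht
    have h1 := (hsub 1 (.inl rfl)).measure_ge_le (sqrt_nonneg (A + t))
    have h2 := (hsub (-1) (.inr rfl)).measure_ge_le (sqrt_nonneg (A + t))
    rw [sq_sqrt (by positivity)] at h1 h2
    have hss : {z : ℝ | t < max (z ^ 2 - A) 0} ⊆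
        {z | √(A + t) ≤ 1 * z} ∪ {z | √(A + t) ≤ -1 * z} := by
      intro z hz
      have hz' : A + t ≤ z ^ 2 := by
        rcases lt_max_iff.1 (Set.mem_ofPred.1 hz) with h | h <;> linarith
      have := sqrt_le_sqrt hz'
      rw [sqrt_sq_eq_abs] at this
      rcases abs_choice z with h | h <;> rw [h] at this
      · left; simpa using this
      · right; simpa using this
    have h3 := (measureReal_mono hss).trans (measureReal_union_le (μ := gaussianReal 0 1) _ _)
    simp only [NNReal.coe_one, mul_one] at h1 h2
    linarith
  have hexp : ∀ t : ℝ, 2 * exp (-(A + t) / 2) = (2 * exp (-A / 2)) * exp (-1 / 2 * t) := by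
    intro t
    rw [mul_assoc, ← exp_add]
    ring_nf
  have hintexp : IntegrableOn (fun t : ℝ => 2 * exp (-(A + t) / 2)) (Set.Ioi 0) := by
    simp_rw [hexp]
    exact (integrableOn_exp_mul_Ioi (by norm_num) 0).const_mul _
  calc _ ≤ ∫ t in Set.Ioi (0 : ℝ), 2 * exp (-(A + t) / 2) := by
        refine integral_mono_of_nonneg (.of_forall fun t => measureReal_nonneg) hintexp ?_
        exact (ae_restrict_iff' measurableSet_Ioi).2 (.of_forall fun t ht => htail t ht)
    _ = _ := by
        simp_rw [hexp]
        rw [integral_const_mul, integral_exp_mul_Ioi (by norm_num)]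
        norm_num
        ring

lemma integrable_max_sq_div_sub {Ω : Type*} [MeasurableSpace Ω] {P : Measure Ω}
    [IsProbabilityMeasure P] {X : Ω → ℝ} (hX : MemLp X 2 P) (v A : ℝ) :
    Integrable (fun ω => max (X ω ^ 2 / v - A) 0) P :=
  ((hX.integrable_sq.div_const _).sub (integrable_const _)).pos_part

lemma integral_max_sq_div_sub_le {Ω : Type*} [MeasurableSpace Ω] {P : Measure Ω}
    [IsProbabilityMeasure P] {X : Ω → ℝ} {v : ℝ≥0} (hX : Measurable X)
    (hlaw : P.map X = gaussianReal 0 v) {A : ℝ} (hA : 0 ≤ A) :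
    ∫ ω, max (X ω ^ 2 / v - A) 0 ∂P ≤ 4 * exp (-A / 2) := by
  -- For v = 0 the quotient is 0 by convention and the integrand vanishes because A ≥ 0.
  rcases eq_or_ne v 0 with rfl | hv
  · simp [hA]
    positivity
  have hv' : (0 : ℝ) < v := by positivity
  have h1 : P.map (fun ω => X ω / √v) = gaussianReal 0 1 := by
    rw [show (fun ω => X ω / √v) = (fun y => y / √v) ∘ X from rfl,
      ← Measure.map_map (by fun_prop) hX, hlaw, gaussianReal_map_div_const]
    congr 1
    · simp
    · ext; simp [hv]
  have h2 := integral_max_sq_sub_gaussianReal_le hA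
  rw [← h1, integral_map (by fun_prop) (by fun_prop)] at h2
  simpa [div_pow] using h2

end GaussianTail

/-! ### The constant relating variance to information -/

section Constants

open Real

lemma Cσ_pos {σ : ℝ} (hσ : 0 < σ) : 0 < Cσ σ := by
  have : 0 < log (1 + (σ ^ 2)⁻¹) := log_pos (by linarith [inv_pos.2 (pow_pos hσ 2)])
  unfold Cσ
  positivity

/-- On [0, 1] the concave function v ↦ log(1 + v/σ²) lies above its chord, whose slope is 2 / `Cσ
σ`. This is where variances at most one are needed. -/
lemma le_Cσ_mul_log {σ v : ℝ} (hσ : 0 < σ) (hv : 0 ≤ v) (hv1 : v ≤ 1) :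
    v ≤ Cσ σ * (1 / 2 * log (1 + (σ ^ 2)⁻¹ * v)) := by
  have hq : 0 < (σ ^ 2)⁻¹ := by positivity
  have hL : 0 < log (1 + (σ ^ 2)⁻¹) := log_pos (by linarith)
  have h := strictConcaveOn_log_Ioi.concaveOn.2 (Set.mem_Ioi.2 one_pos)
    (Set.mem_Ioi.2 (by linarith : 0 < 1 + (σ ^ 2)⁻¹)) (sub_nonneg.2 hv1) hv (by ring)
  simp only [smul_eq_mul, log_one, mul_zero, zero_add] at h
  rw [show (1 - v) * 1 + v * (1 + (σ ^ 2)⁻¹) = 1 + (σ ^ 2)⁻¹ * v by ring] at h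
  rw [Cσ, show 2 / log (1 + (σ ^ 2)⁻¹) * (1 / 2 * log (1 + (σ ^ 2)⁻¹ * v)) =
    log (1 + (σ ^ 2)⁻¹ * v) / log (1 + (σ ^ 2)⁻¹) by ring, le_div_iff₀ hL]
  exact h

end Constants

/-! ### One step of Gaussian linear regression -/

section Regression

variable {Ω ι : Type*} [MeasurableSpace Ω] {P : Measure Ω}

/-- The residual of the linear regression of `R` on the noisy observation `R b + e`. -/
noncomputable def regress (P : Measure Ω) (R : Ω → ι → ℝ) (e : Ω → ℝ) (b : ι) (ω : Ω) (a : ι) : ℝ :=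
  R ω a - cov[fun ω => R ω a, fun ω => R ω b; P] / (Var[fun ω => R ω b; P] + Var[e; P]) *
    (R ω b + e ω)

lemma covariance_eq_zero_of_variance_eq_zero [IsFiniteMeasure P] {X Y : Ω → ℝ} (hY : MemLp Y 2 P)
    (h : Var[Y; P] = 0) : cov[X, Y; P] = 0 := by
  rw [covariance]
  refine integral_eq_zero_of_ae ?_
  filter_upwards [ae_eq_integral_of_variance_eq_zero hY h] with ω hω
  simp [hω]

lemma measurable_regress {R : Ω → ι → ℝ} {e : Ω → ℝ} (hR : Measurable R) (he : Measurable e)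
    (b : ι) : Measurable (regress P R e b) := by
  refine measurable_pi_lambda _ fun a => ?_
  unfold regress
  fun_prop

variable {R : Ω → ι → ℝ} {e : Ω → ℝ}

lemma covariance_regress [IsProbabilityMeasure P] (hR : HasGaussianLaw R P)
    (he : HasGaussianLaw e P) (hind : IndepFun R e P) (a b : ι) :
    cov[fun ω => regress P R e b ω a, fun ω => R ω b + e ω; P] = 0 := by
  have hRm (a : ι) : MemLp (fun ω => R ω a) 2 P := (HasGaussianLaw.eval hR a).memLp_two
  have hem : MemLp e 2 P := he.memLp_two
  have hym : MemLp (fun ω => R ω b + e ω) 2 P := (hRm b).add hem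
  have hcov (a : ι) : cov[fun ω => R ω a, e; P] = 0 :=
    (hind.comp (φ := fun r : ι → ℝ => r a) (ψ := id) (by fun_prop)
      measurable_id).covariance_eq_zero (hRm a) hem
  have h1 : cov[fun ω => R ω a, fun ω => R ω b + e ω; P] =
      cov[fun ω => R ω a, fun ω => R ω b; P] := by
    rw [show (fun ω => R ω b + e ω) = (fun ω => R ω b) + e from rfl,
      covariance_add_right (hRm a) (hRm b) hem, hcov, add_zero]
  have h2 : cov[fun ω => R ω b + e ω, fun ω => R ω b + e ω; P] =
      Var[fun ω => R ω b; P] + Var[e; P] := by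
    rw [covariance_self hym.aemeasurable]
    exact IndepFun.variance_add (hRm b) hem
      (hind.comp (φ := fun r : ι → ℝ => r b) (ψ := id) (by fun_prop) measurable_id)
  unfold regress
  rw [covariance_fun_sub_left (hRm a) (hym.const_mul _) hym, covariance_const_mul_left, h1, h2]
  -- If the observation has variance zero, the regression coefficient is 0 by the convention on
  -- division; this is still right, as the covariance vanishes too.
  rcases eq_or_ne (Var[fun ω => R ω b; P] + Var[e; P]) 0 with h0 | h0
  · have h3 : Var[fun ω => R ω b; P] = 0 := by
      linarith [variance_nonneg (fun ω => R ω b) P, variance_nonneg e P]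
    rw [covariance_eq_zero_of_variance_eq_zero (hRm b) h3]
    simp
  · field_simp
    ring

lemma integral_regress [IsProbabilityMeasure P] (hR : HasGaussianLaw R P)
    (he : HasGaussianLaw e P) (hR0 : ∀ a, ∫ ω, R ω a ∂P = 0) (he0 : ∫ ω, e ω ∂P = 0) (a b : ι) :
    ∫ ω, regress P R e b ω a ∂P = 0 := by
  have hRi (a : ι) : Integrable (fun ω => R ω a) P := (HasGaussianLaw.eval hR a).integrable
  have hyi : Integrable (fun ω => R ω b + e ω) P := (hRi b).add he.integrable
  unfold regress
  rw [integral_sub (hRi a) (hyi.const_mul _), integral_const_mul,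
    integral_add (hRi b) he.integrable, hR0, hR0, he0]
  simp

variable [Fintype ι]

/-- A continuous linear image of the jointly Gaussian pair (R, e). The observation is a family over
`Unit` because the independence criterion of `indepFun_regress` is about families. -/
lemma hasGaussianLaw_regress_prodMk (hR : HasGaussianLaw R P) (he : HasGaussianLaw e P)
    (hind : IndepFun R e P) (b : ι) :
    HasGaussianLaw (fun ω => (regress P R e b ω, fun _ : Unit => R ω b + e ω)) P := by
  let c (a : ι) : ℝ :=
    cov[fun ω => R ω a, fun ω => R ω b; P] / (Var[fun ω => R ω b; P] + Var[e; P])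
  let p (a : ι) : (ι → ℝ) × ℝ →L[ℝ] ℝ :=
    (ContinuousLinearMap.proj (R := ℝ) (φ := fun _ : ι => ℝ) a).comp (.fst ℝ (ι → ℝ) ℝ)
  let y : (ι → ℝ) × ℝ →L[ℝ] ℝ := p b + .snd ℝ (ι → ℝ) ℝ
  exact (hind.hasGaussianLaw hR he).map_fun
    ((ContinuousLinearMap.pi fun a => p a - c a • y).prod (.pi fun _ : Unit => y))

/-- Jointly Gaussian and uncorrelated implies independent. -/
lemma indepFun_regress [IsProbabilityMeasure P] (hR : HasGaussianLaw R P)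
    (he : HasGaussianLaw e P) (hind : IndepFun R e P) (b : ι) :
    IndepFun (regress P R e b) (fun ω => R ω b + e ω) P := by
  have h := HasGaussianLaw.indepFun_of_covariance_eval (P := P)
    (X := fun a ω => regress P R e b ω a) (Y := fun (_ : Unit) ω => R ω b + e ω)
    (hasGaussianLaw_regress_prodMk hR he hind b)
    (fun a _ => covariance_regress hR he hind a b)
  exact h.comp (φ := id) (ψ := fun f : Unit → ℝ => f ()) measurable_id (by fun_prop)

/-- Pythagoras: R a is the residual plus an uncorrelated multiple of the observation. -/
lemma variance_regress_le [IsProbabilityMeasure P] (hR : HasGaussianLaw R P)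
    (he : HasGaussianLaw e P) (hind : IndepFun R e P) (a b : ι) :
    Var[fun ω => regress P R e b ω a; P] ≤ Var[fun ω => R ω a; P] := by
  set c : ℝ := cov[fun ω => R ω a, fun ω => R ω b; P] / (Var[fun ω => R ω b; P] + Var[e; P])
    with hc
  have hym : MemLp (fun ω => c * (R ω b + e ω)) 2 P :=
    (((HasGaussianLaw.eval hR b).memLp_two).add he.memLp_two).const_mul _
  have hrm : MemLp (fun ω => regress P R e b ω a) 2 P :=
    (HasGaussianLaw.eval (hasGaussianLaw_regress_prodMk hR he hind b).fst a).memLp_two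
  have h1 : (fun ω => R ω a) = (fun ω => regress P R e b ω a) + fun ω => c * (R ω b + e ω) := by
    ext ω
    simp [regress, hc]
  rw [h1, variance_add hrm hym, covariance_const_mul_right, covariance_regress hR he hind a b]
  linarith [variance_nonneg (fun ω => c * (R ω b + e ω)) P]

end Regression

/-! ### Residuals for a fixed sequence of locations -/

section FixedDesign

variable {Ω X : Type*}

/-- The first `n` noisy observations at the locations `z 0, z 1, …`. -/
def designObs (robs : Ω → X → ℝ) (η : ℕ → Ω → ℝ) (z : ℕ → X) (n : ℕ) (ω : Ω) (i : Fin n) : ℝ :=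
  robs ω (z i) + η i ω

lemma designObs_succ (robs : Ω → X → ℝ) (η : ℕ → Ω → ℝ) (z : ℕ → X) (n : ℕ) (ω : Ω) :
    designObs robs η z (n + 1) ω =
      Fin.snoc (designObs robs η z n ω) (robs ω (z n) + η n ω) := by
  ext i
  induction i using Fin.lastCases with
  | last => simp [designObs]
  | cast i => simp [designObs]

variable [MeasurableSpace Ω] {P : Measure Ω}

/-- The difference between `robs` and its best prediction from the first `n` noisy observations at
the locations `z 0, z 1, …`. -/
noncomputable def residual (P : Measure Ω) (m : X → ℝ) (robs : Ω → X → ℝ) (η : ℕ → Ω → ℝ)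
    (z : ℕ → X) : ℕ → Ω → X → ℝ
  | 0 => fun ω a => robs ω a - m a
  -- The regression is on the innovation, i.e. the new observation minus its prediction from the
  -- earlier ones.
  | n + 1 => regress P (residual P m robs η z n) (η n) (z n)

lemma measurable_residual {m : X → ℝ} {robs : Ω → X → ℝ} {η : ℕ → Ω → ℝ} (hr : Measurable robs)
    (hη : ∀ n, Measurable (η n)) (z : ℕ → X) (n : ℕ) : Measurable (residual P m robs η z n) := by
  induction n with
  | zero => exact measurable_pi_lambda _ fun a => by unfold residual; fun_prop
  | succ n ih => exact measurable_regress ih (hη n) _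

lemma measurable_designObs {robs : Ω → X → ℝ} {η : ℕ → Ω → ℝ} (hr : Measurable robs)
    (hη : ∀ n, Measurable (η n)) (z : ℕ → X) (n : ℕ) : Measurable (designObs robs η z n) :=
  measurable_pi_lambda _ fun i => by
    have := hη i
    unfold designObs
    fun_prop

lemma residual_congr (m : X → ℝ) (robs : Ω → X → ℝ) (η : ℕ → Ω → ℝ) {z z' : ℕ → X} {n : ℕ}
    (h : ∀ i < n, z i = z' i) : residual P m robs η z n = residual P m robs η z' n := by
  induction n with
  | zero => rfl
  | succ n ih =>
    rw [residual, residual, ih fun i hi => h i (hi.trans n.lt_succ_self), h n n.lt_succ_self]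

lemma measurable_finSnoc (n : ℕ) :
    Measurable fun p : (Fin n → ℝ) × ℝ => (Fin.snoc p.1 p.2 : Fin (n + 1) → ℝ) := by
  refine measurable_pi_lambda _ fun i => ?_
  induction i using Fin.lastCases with
  | last => simpa using measurable_snd
  | cast i => simpa using! (measurable_pi_apply i).comp measurable_fst

/-- The prediction of `robs` is a function of the observations. -/
lemma exists_residual_eq_sub (P : Measure Ω) (m : X → ℝ) (robs : Ω → X → ℝ) (η : ℕ → Ω → ℝ)
    (z : ℕ → X) (n : ℕ) :
    ∃ g : (Fin n → ℝ) → X → ℝ, Measurable g ∧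
      ∀ ω a, residual P m robs η z n ω a = robs ω a - g (designObs robs η z n ω) a := by
  induction n with
  | zero => exact ⟨fun _ => m, measurable_const, fun ω a => rfl⟩
  | succ n ih =>
    obtain ⟨g, hg, hgr⟩ := ih
    let c (a : X) : ℝ :=
      cov[fun ω => residual P m robs η z n ω a, fun ω => residual P m robs η z n ω (z n); P] /
        (Var[fun ω => residual P m robs η z n ω (z n); P] + Var[η n; P])
    refine ⟨fun y a => g (fun i => y i.castSucc) a +
      c a * (y (Fin.last n) - g (fun i => y i.castSucc) (z n)), ?_, fun ω a => ?_⟩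
    · refine measurable_pi_lambda _ fun a => ?_
      have h1 : Measurable fun y : Fin (n + 1) → ℝ => g (fun i => y i.castSucc) :=
        hg.comp (by fun_prop)
      fun_prop
    · have h1 : (fun i : Fin n => designObs robs η z (n + 1) ω i.castSucc) =
          designObs robs η z n ω := rfl
      have h2 : designObs robs η z (n + 1) ω (Fin.last n) = robs ω (z n) + η n ω := by
        simp [designObs]
      simp only [h1, h2]
      change residual P m robs η z n ω a - c a * (residual P m robs η z n ω (z n) + η n ω) = _
      rw [hgr, hgr]
      ring

end FixedDesign

/-! ### Independence of residuals and hidden rewards from the played sequence -/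

section AdaptiveDesign

set_option linter.unusedSectionVars false

variable {Ω X : Type*} [MeasurableSpace Ω] [Fintype X] [DecidableEq X] [MeasurableSpace X]
  [MeasurableSingletonClass X] {P : Measure Ω} [IsProbabilityMeasure P]
  {m : EuclideanSpace ℝ X} {S : Matrix X X ℝ} {τ : ℕ → ℝ≥0} {σ : ℝ}
  {robs rhid : Ω → X → ℝ} {η : ℕ → Ω → ℝ} {xs xobs : Ω → X} {x : ℕ → Ω → X}

/-- The event that the actions before round `n` are `z 0, …, z (n - 1)`. -/
def playedBefore (x : ℕ → Ω → X) (z : ℕ → X) (n : ℕ) : Set Ω := {ω | ∀ i < n, x i ω = z i}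

namespace Setting

lemma measurable_eval_prod : Measurable fun p : (X → ℝ) × X => p.1 p.2 :=
  measurable_from_prod_countable_left fun a => measurable_pi_apply a

lemma measurable_hist (h : Setting P m S τ σ robs rhid η xs xobs x) (n : ℕ) :
    Measurable (hist robs η x n) := by
  refine measurable_pi_lambda _ fun i => (h.measurable_x i).prodMk ?_
  have h1 : Measurable fun ω => robs ω (x i ω) :=
    measurable_eval_prod.comp (h.measurable_robs.prodMk (h.measurable_x i))
  exact h1.add (h.measurable_η i)

lemma measurable_history (h : Setting P m S τ σ robs rhid η xs xobs x) (n : ℕ) :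
    Measurable fun ω => (robs ω, rhid ω, hist robs η x n ω) :=
  h.measurable_robs.prodMk (h.measurable_rhid.prodMk (h.measurable_hist n))

lemma law_robs_apply (h : Setting P m S τ σ robs rhid η xs xobs x) (a : X) :
    P.map (fun ω => robs ω a) = gaussianReal (m a) (S a a).toNNReal := by
  have hm : Measurable fun ω => WithLp.toLp 2 (robs ω) :=
    (WithLp.measurable_toLp 2 _).comp h.measurable_robs
  rw [← (measurePreserving_eval_multivariateGaussian h.posSemidef (μ := m) (i := a)).map_eq,
    ← h.law_robs, Measure.map_map (by fun_prop) hm]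
  rfl

lemma hasGaussianLaw_noise (h : Setting P m S τ σ robs rhid η xs xobs x) (n : ℕ) :
    HasGaussianLaw (η n) P := ⟨by rw [h.law_η n]; infer_instance⟩

lemma integral_noise (h : Setting P m S τ σ robs rhid η xs xobs x) (n : ℕ) :
    ∫ ω, η n ω ∂P = 0 := by
  have h1 := integral_id_gaussianReal (μ := 0) (v := τ n ^ 2)
  rwa [← h.law_η n, integral_map (h.measurable_η n).aemeasurable (by fun_prop)] at h1

lemma hasGaussianLaw_residual_zero (h : Setting P m S τ σ robs rhid η xs xobs x) :
    HasGaussianLaw (fun ω a => robs ω a - m a) P := by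
  have hm : Measurable fun ω => WithLp.toLp 2 (robs ω) :=
    (WithLp.measurable_toLp 2 _).comp h.measurable_robs
  have h1 : HasGaussianLaw (fun ω => WithLp.toLp 2 (robs ω) - m) P := by
    constructor
    rw [show (fun ω => WithLp.toLp 2 (robs ω) - m) =
      (fun y => y - m) ∘ fun ω => WithLp.toLp 2 (robs ω) from rfl,
      ← Measure.map_map (by fun_prop) hm, h.law_robs]
    infer_instance
  exact h1.map_equiv_fun (PiLp.continuousLinearEquiv 2 ℝ (fun _ : X => ℝ))

lemma integral_residual_zero (h : Setting P m S τ σ robs rhid η xs xobs x) (a : X) :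
    ∫ ω, (robs ω a - m a) ∂P = 0 := by
  have hm : Measurable fun ω => robs ω a := (measurable_pi_apply a).comp h.measurable_robs
  have h1 := integral_id_gaussianReal (μ := m a) (v := (S a a).toNNReal)
  have h2 : Integrable (fun y : ℝ => y) (gaussianReal (m a) (S a a).toNNReal) :=
    memLp_one_iff_integrable.1 (memLp_id_gaussianReal' 1 (by simp))
  rw [← h.law_robs_apply a] at h1 h2
  rw [integral_map hm.aemeasurable (by fun_prop)] at h1
  have h3 : Integrable (fun ω => robs ω a) P := h2.comp_measurable hm
  rw [integral_sub h3 (integrable_const _)]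
  simp [h1]

lemma variance_residual_zero_le (h : Setting P m S τ σ robs rhid η xs xobs x) (a : X) :
    Var[fun ω => robs ω a - m a; P] ≤ 1 := by
  have hm : Measurable fun ω => robs ω a := (measurable_pi_apply a).comp h.measurable_robs
  have h1 := variance_fun_id_gaussianReal (μ := m a) (v := (S a a).toNNReal)
  rw [← h.law_robs_apply a, variance_map (by fun_prop) hm.aemeasurable] at h1
  rw [variance_sub_const hm.aestronglyMeasurable]
  exact h1.trans_le (by simpa using h.variance_le a)

lemma measurableSet_playedBefore (h : Setting P m S τ σ robs rhid η xs xobs x) (z : ℕ → X)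
    (n : ℕ) : MeasurableSet (playedBefore x z n) := by
  rw [show playedBefore x z n = ⋂ i < n, x i ⁻¹' {z i} by ext; simp [playedBefore]]
  exact .iInter fun i => .iInter fun _ => h.measurable_x i (measurableSet_singleton _)

lemma playedBefore_succ (x : ℕ → Ω → X) (z : ℕ → X) (n : ℕ) :
    playedBefore x z (n + 1) = playedBefore x z n ∩ x n ⁻¹' {z n} := by
  ext ω
  simp only [playedBefore, Set.mem_ofPred_eq, Set.mem_inter_iff, Set.mem_preimage,
    Set.mem_singleton_iff, Nat.lt_succ_iff_lt_or_eq]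
  exact ⟨fun h => ⟨fun i hi => h i (.inl hi), h n (.inr rfl)⟩,
    fun h i hi => hi.elim (h.1 i) (fun e => e ▸ h.2)⟩

lemma measurableSet_comap_playedBefore (z : ℕ → X) (n : ℕ) :
    MeasurableSet[MeasurableSpace.comap (hist robs η x n) inferInstance]
      (playedBefore x z n) := by
  refine ⟨{p | ∀ i : Fin n, (p i).1 = z i}, ?_, ?_⟩
  · rw [show {p : Fin n → X × ℝ | ∀ i : Fin n, (p i).1 = z i} =
      ⋂ i : Fin n, (fun p => (p i).1) ⁻¹' {z i} by ext; simp]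
    exact .iInter fun i => (by fun_prop : Measurable fun p : Fin n → X × ℝ => (p i).1)
      (measurableSet_singleton _)
  · ext ω
    simp [playedBefore, hist, Fin.forall_iff]

lemma comap_hist_le_comap_history (n : ℕ) :
    MeasurableSpace.comap (hist robs η x n) inferInstance ≤
      MeasurableSpace.comap (fun ω => (robs ω, rhid ω, hist robs η x n ω)) inferInstance := by
  rw [show hist robs η x n =
    (fun p : (X → ℝ) × (X → ℝ) × (Fin n → X × ℝ) => p.2.2) ∘
      fun ω => (robs ω, rhid ω, hist robs η x n ω) from rfl, ← MeasurableSpace.comap_comp]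
  exact MeasurableSpace.comap_mono (measurable_snd.comp measurable_snd).comap_le

/-- The noise can be recovered from rewards and history as y_i − `robs` (x_i), so the observations
at z are determined by the past even where z was not played. -/
lemma measurable_comap_designObs (z : ℕ → X) (n : ℕ) :
    Measurable[MeasurableSpace.comap (fun ω => (robs ω, rhid ω, hist robs η x n ω)) inferInstance]
      (designObs robs η z n) := by
  have h1 : Measurable fun (p : (X → ℝ) × (X → ℝ) × (Fin n → X × ℝ)) (i : Fin n) =>
      p.1 (z i) + ((p.2.2 i).2 - p.1 (p.2.2 i).1) := by
    refine measurable_pi_lambda _ fun i => ?_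
    have h2 : Measurable fun p : (X → ℝ) × (X → ℝ) × (Fin n → X × ℝ) => p.1 (p.2.2 i).1 :=
      measurable_eval_prod.comp (by fun_prop :
        Measurable fun p : (X → ℝ) × (X → ℝ) × (Fin n → X × ℝ) => (p.1, (p.2.2 i).1))
    fun_prop
  convert! h1.comp (comap_measurable fun ω => (robs ω, rhid ω, hist robs η x n ω)) using 1
  ext ω i
  simp [designObs, hist, obs]

lemma measurable_comap_residual (P : Measure Ω) (m : X → ℝ) (z : ℕ → X) (n : ℕ) :
    Measurable[MeasurableSpace.comap (fun ω => (robs ω, rhid ω, hist robs η x n ω)) inferInstance]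
      (residual P m robs η z n) := by
  obtain ⟨g, hg, hgr⟩ := exists_residual_eq_sub P m robs η z n
  have h1 : Measurable fun (p : (X → ℝ) × (Fin n → ℝ)) (a : X) => p.1 a - g p.2 a :=
    measurable_pi_lambda _ fun a => by fun_prop
  have h2 : Measurable[MeasurableSpace.comap (fun ω => (robs ω, rhid ω, hist robs η x n ω))
      inferInstance] robs :=
    measurable_fst.comp (comap_measurable fun ω => (robs ω, rhid ω, hist robs η x n ω))
  convert! h1.comp (h2.prodMk (measurable_comap_designObs z n)) using 1
  ext ω a
  exact hgr ω a

/-- Given the past, the probability of playing `a` after `z 0, …, z (n - 1)` is a function of the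
observations only. -/
lemma exists_condExp_choice (h : Setting P m S τ σ robs rhid η xs xobs x) (z : ℕ → X) (n : ℕ)
    (a : X) :
    ∃ f : (Fin n → ℝ) × ℝ → ℝ, Measurable f ∧
      P⟦playedBefore x z n ∩ x n ⁻¹' {a} | MeasurableSpace.comap
        (fun ω => (robs ω, rhid ω, hist robs η x n ω)) inferInstance⟧ =ᵐ[P]
      fun ω => f (designObs robs η z n ω, (playedBefore x z n).indicator (fun _ => 1) ω) := by
  obtain ⟨π, hπ, hπeq⟩ := (stronglyMeasurable_condExp (μ := P)
    (f := (xs ⁻¹' {a}).indicator fun _ => (1 : ℝ))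
    (m := MeasurableSpace.comap (hist robs η x n) inferInstance)).measurable.exists_eq_measurable_comp
  -- π is the Thompson probability of a as a function of the history. On the event that z was played
  -- the history consists of the pairs of z and the fixed-design observations; off it the factor
  -- `p.2` is 0.
  refine ⟨fun p => p.2 * π fun i => (z i, p.1 i), ?_, ?_⟩
  · have h1 : Measurable fun p : (Fin n → ℝ) × ℝ => π fun i : Fin n => (z i, p.1 i) :=
      hπ.comp (by fun_prop)
    fun_prop
  · have h2 := condExp_indicator (μ := P)
      (m := MeasurableSpace.comap (fun ω => (robs ω, rhid ω, hist robs η x n ω)) inferInstance)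
      (f := (x n ⁻¹' {a}).indicator fun _ => (1 : ℝ)) (s := playedBefore x z n)
      ((integrable_const _).indicator (h.measurable_x n (measurableSet_singleton a)))
      (comap_hist_le_comap_history n _ (measurableSet_comap_playedBefore z n))
    rw [Set.indicator_indicator] at h2
    filter_upwards [h2, h.sampled_x n a] with ω h3 h4
    rw [h3]
    by_cases hω : ω ∈ playedBefore x z n
    · rw [Set.indicator_of_mem hω, Set.indicator_of_mem hω, h4, hπeq, one_mul, Function.comp]
      congr 1
      ext i
      · exact hω i i.2
      · simp only [hist, obs, designObs]
        rw [hω i i.2]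
    · rw [Set.indicator_of_notMem hω, Set.indicator_of_notMem hω, zero_mul]

/-- K determines the observations and whether z was played, hence the conditional probability of the
next choice given the past. Joining that choice to K therefore preserves independence from V. -/
lemma indepFun_choice (h : Setting P m S τ σ robs rhid η xs xobs x) (z : ℕ → X) (n : ℕ) (a : X)
    {α β : Type*} [MeasurableSpace α] [MeasurableSpace β] {V : Ω → α} {K : Ω → β}
    {ψ : β → (Fin n → ℝ) × ℝ} (hψ : Measurable ψ)
    (hKψ : ∀ ω, ψ (K ω) =
      (designObs robs η z n ω, (playedBefore x z n).indicator (fun _ => 1) ω))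
    (hV : Measurable[MeasurableSpace.comap (fun ω => (robs ω, rhid ω, hist robs η x n ω))
      inferInstance] V)
    (hK : Measurable[MeasurableSpace.comap (fun ω => (robs ω, rhid ω, hist robs η x n ω))
      inferInstance] K)
    (hVK : IndepFun V K P) :
    IndepFun V (fun ω => (K ω,
      (playedBefore x z n ∩ x n ⁻¹' {a}).indicator (fun _ => (1 : ℝ)) ω)) P := by
  obtain ⟨f, hf, hfe⟩ := h.exists_condExp_choice z n a
  refine IndepFun.prodMk_indicator (h.measurable_history n) hV hK
    ((h.measurableSet_playedBefore z n).inter (h.measurable_x n (measurableSet_singleton a)))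
    (f := fun ω => f (ψ (K ω))) ((hf.comp hψ).comp (comap_measurable K)) ?_ hVK
  simp_rw [hKψ]
  exact hfe

lemma measurable_comap_indicator_playedBefore (z : ℕ → X) (n : ℕ) :
    Measurable[MeasurableSpace.comap (fun ω => (robs ω, rhid ω, hist robs η x n ω)) inferInstance]
      ((playedBefore x z n).indicator fun _ => (1 : ℝ)) :=
  measurable_const.indicator
    (comap_hist_le_comap_history n _ (measurableSet_comap_playedBefore z n))

/-- The noise of round `n` is independent of everything that is determined by the past and the
action of round `n`. -/
lemma indepFun_noise (h : Setting P m S τ σ robs rhid η xs xobs x) (z : ℕ → X) (n : ℕ)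
    {α : Type*} [MeasurableSpace α] {V : Ω → α}
    (hV : Measurable[MeasurableSpace.comap (fun ω => (robs ω, rhid ω, hist robs η x n ω))
      inferInstance] V) :
    IndepFun (fun ω => (V ω, (playedBefore x z (n + 1)).indicator (fun _ => (1 : ℝ)) ω)) (η n)
      P := by
  refine IndepFun.symm (indep_of_indep_of_le_right (h.indep_η n) ?_)
  set G' := fun ω => (robs ω, rhid ω, hist robs η x n ω, x n ω)
  have hle : MeasurableSpace.comap (fun ω => (robs ω, rhid ω, hist robs η x n ω)) inferInstance ≤
      MeasurableSpace.comap G' inferInstance := by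
    rw [show (fun ω => (robs ω, rhid ω, hist robs η x n ω)) =
      (fun p : (X → ℝ) × (X → ℝ) × (Fin n → X × ℝ) × X => (p.1, p.2.1, p.2.2.1)) ∘ G' from rfl,
      ← MeasurableSpace.comap_comp]
    exact MeasurableSpace.comap_mono (Measurable.comap_le (by fun_prop))
  have hx : Measurable[MeasurableSpace.comap G' inferInstance] (x n) :=
    (by fun_prop : Measurable fun p : (X → ℝ) × (X → ℝ) × (Fin n → X × ℝ) × X => p.2.2.2).comp
      (comap_measurable G')
  have hA : MeasurableSet[MeasurableSpace.comap G' inferInstance] (playedBefore x z (n + 1)) := by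
    rw [playedBefore_succ]
    exact (hle _ (comap_hist_le_comap_history n _ (measurableSet_comap_playedBefore z n))).inter
      (hx (measurableSet_singleton _))
  exact ((hV.mono hle le_rfl).prodMk (measurable_const.indicator hA)).comap_le

lemma measurable_indicator_playedBefore (h : Setting P m S τ σ robs rhid η xs xobs x)
    (z : ℕ → X) (n : ℕ) :
    Measurable ((playedBefore x z n).indicator fun _ => (1 : ℝ)) :=
  measurable_const.indicator (h.measurableSet_playedBefore z n)

/-- The residual of the fixed design `z` is a centred Gaussian vector that is independent of the
observations and of the event that `z` is played. -/
lemma residual_spec (h : Setting P m S τ σ robs rhid η xs xobs x) (z : ℕ → X) (n : ℕ) :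
    HasGaussianLaw (residual P m robs η z n) P ∧
    (∀ a, ∫ ω, residual P m robs η z n ω a ∂P = 0) ∧
    (∀ a, Var[fun ω => residual P m robs η z n ω a; P] ≤ 1) ∧
    IndepFun (residual P m robs η z n) (fun ω => (designObs robs η z n ω,
      (playedBefore x z n).indicator (fun _ => (1 : ℝ)) ω)) P := by
  induction n with
  | zero =>
    refine ⟨h.hasGaussianLaw_residual_zero, h.integral_residual_zero,
      h.variance_residual_zero_le, ?_⟩
    have h1 : (fun ω => (designObs robs η z 0 ω,
        (playedBefore x z 0).indicator (fun _ => (1 : ℝ)) ω)) = fun _ => (fun i => i.elim0, 1) := by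
      ext ω i
      · exact i.elim0
      · simp [playedBefore]
    rw [h1]
    exact indepFun_const_right _ _
  | succ n ih =>
    obtain ⟨hG, h0, hv, hind⟩ := ih
    have hR := measurable_residual (P := P) (m := m) h.measurable_robs h.measurable_η z n
    have hY := measurable_designObs h.measurable_robs h.measurable_η z n
    have hη := h.measurable_η n
    have hA := h.measurable_indicator_playedBefore z (n + 1)
    -- First the action of round n is absorbed into the event; the noise of that round enters
    -- afterwards.
    have hK : IndepFun (residual P m robs η z n) (fun ω => (designObs robs η z n ω,
        (playedBefore x z (n + 1)).indicator (fun _ => (1 : ℝ)) ω)) P := by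
      have h1 := h.indepFun_choice z n (z n) measurable_id (fun ω => rfl)
        (measurable_comap_residual (rhid := rhid) (x := x) P m z n)
        ((measurable_comap_designObs z n).prodMk (measurable_comap_indicator_playedBefore z n)) hind
      rw [playedBefore_succ]
      exact h1.comp (φ := id) (ψ := fun p : ((Fin n → ℝ) × ℝ) × ℝ => (p.1.1, p.2)) measurable_id
        (by fun_prop)
    have hnoise := h.indepFun_noise z n
      ((measurable_comap_residual (rhid := rhid) (x := x) P m z n).prodMk
        (measurable_comap_designObs z n))
    have hRη : IndepFun (residual P m robs η z n) (η n) P :=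
      hnoise.comp (φ := fun p : ((X → ℝ) × (Fin n → ℝ)) × ℝ => p.1.1) (ψ := id) (by fun_prop)
        measurable_id
    have hηG := h.hasGaussianLaw_noise n
    refine ⟨(hasGaussianLaw_regress_prodMk hG hηG hRη (z n)).fst,
      fun a => integral_regress hG hηG h0 (h.integral_noise n) a (z n),
      fun a => (variance_regress_le hG hηG hRη a (z n)).trans (hv a), ?_⟩
    obtain ⟨g, hg, hgr⟩ := exists_residual_eq_sub P m robs η z n
    set R := residual P m robs η z n with hRdef
    set K : Ω → (Fin n → ℝ) × ℝ := fun ω => (designObs robs η z n ω,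
        (playedBefore x z (n + 1)).indicator (fun _ => (1 : ℝ)) ω) with hKdef
    have hKm : Measurable K := hY.prodMk hA
    have h2 : IndepFun (fun ω => (K ω, R ω)) (η n) P :=
      hnoise.comp (φ := fun p : ((X → ℝ) × (Fin n → ℝ)) × ℝ => ((p.1.2, p.2), p.1.1)) (ψ := id)
        (by fun_prop) measurable_id
    have h3 : IndepFun (fun ω => (R ω, η n ω)) K P :=
      (indepFun_prodMk_of_indepFun_prodMk hKm hR hη hK.symm h2).symm
    have h4 : IndepFun (fun ω => (regress P R (η n) (z n) ω, R ω (z n) + η n ω)) K P := by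
      refine h3.comp (φ := fun p : (X → ℝ) × ℝ => (fun a => p.1 a -
        cov[fun ω => R ω a, fun ω => R ω (z n); P] /
          (Var[fun ω => R ω (z n); P] + Var[η n; P]) * (p.1 (z n) + p.2), p.1 (z n) + p.2))
        (ψ := id) ?_ measurable_id
      exact Measurable.prodMk (measurable_pi_lambda _ fun a => by fun_prop) (by fun_prop)
    -- The new residual is independent of the innovation, and both together are independent of K, so
    -- it is independent of the innovation and K jointly.
    have h5 := indepFun_prodMk_of_indepFun_prodMk (measurable_regress hR hη (z n))
      (by fun_prop : Measurable fun ω => R ω (z n) + η n ω) hKm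
      (indepFun_regress hG hηG hRη (z n)) h4
    -- Adding the prediction back to the innovation recovers the new observation.
    have h6 : Measurable fun p : ℝ × (Fin n → ℝ) × ℝ =>
        ((Fin.snoc p.2.1 (p.1 + g p.2.1 (z n)) : Fin (n + 1) → ℝ), p.2.2) :=
      Measurable.prodMk ((measurable_finSnoc n).comp
        (by fun_prop : Measurable fun p : ℝ × (Fin n → ℝ) × ℝ => (p.2.1, p.1 + g p.2.1 (z n))))
        (by fun_prop)
    convert! h5.comp measurable_id h6 using 1
    ext ω : 1
    simp only [Function.comp, hKdef, designObs_succ, hgr, sub_add_eq_add_sub, add_sub_cancel_right]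

/-- The hidden rewards are independent of the observable ones, of the observations, and of the event
that `z` is played. -/
lemma indepFun_hidden (h : Setting P m S τ σ robs rhid η xs xobs x) (z : ℕ → X) (n : ℕ) :
    IndepFun rhid (fun ω => (robs ω, designObs robs η z n ω,
      (playedBefore x z n).indicator (fun _ => (1 : ℝ)) ω)) P := by
  induction n with
  | zero =>
    have h1 : (fun ω => (robs ω, designObs robs η z 0 ω,
        (playedBefore x z 0).indicator (fun _ => (1 : ℝ)) ω)) =
        (fun r => (r, fun i => i.elim0, 1)) ∘ robs := by
      ext ω i
      · rfl
      · exact i.elim0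
      · simp [playedBefore]
    rw [h1]
    exact h.indep_rhid.symm.comp measurable_id (by fun_prop)
  | succ n ih =>
    have hY := measurable_designObs h.measurable_robs h.measurable_η z n
    have hη := h.measurable_η n
    have hrobs := h.measurable_robs
    have hrhid := h.measurable_rhid
    have hA := h.measurable_indicator_playedBefore z (n + 1)
    have hfst := comap_measurable (m := inferInstance) fun ω => (robs ω, rhid ω, hist robs η x n ω)
    have hrobs' := measurable_fst.comp hfst
    have hrhid' := (measurable_fst.comp measurable_snd).comp hfst
    have h1 := h.indepFun_choice z n (z n) measurable_snd (fun ω => rfl) hrhid'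
        (hrobs'.prodMk ((measurable_comap_designObs z n).prodMk
          (measurable_comap_indicator_playedBefore z n))) ih
    rw [← playedBefore_succ] at h1
    have h2 : IndepFun rhid (fun ω => (robs ω, designObs robs η z n ω,
        (playedBefore x z (n + 1)).indicator (fun _ => (1 : ℝ)) ω)) P :=
      h1.comp (φ := id) (ψ := fun p : ((X → ℝ) × (Fin n → ℝ) × ℝ) × ℝ => (p.1.1, p.1.2.1, p.2))
        measurable_id (by fun_prop)
    have h3 := h.indepFun_noise z n
      (hrhid'.prodMk (hrobs'.prodMk (measurable_comap_designObs z n)))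
    have h4 : IndepFun (fun ω => (rhid ω, robs ω, designObs robs η z n ω,
        (playedBefore x z (n + 1)).indicator (fun _ => (1 : ℝ)) ω)) (η n) P :=
      h3.comp (φ := fun p : ((X → ℝ) × (X → ℝ) × (Fin n → ℝ)) × ℝ =>
        (p.1.1, p.1.2.1, p.1.2.2, p.2)) (ψ := id) (by fun_prop) measurable_id
    have h5 := indepFun_prodMk_of_indepFun_prodMk hrhid (hrobs.prodMk (hY.prodMk hA)) hη h2 h4
    have h6 : Measurable fun p : ((X → ℝ) × (Fin n → ℝ) × ℝ) × ℝ =>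
        (p.1.1, (Fin.snoc p.1.2.1 (p.1.1 (z n) + p.2) : Fin (n + 1) → ℝ), p.1.2.2) := by
      have := (measurable_finSnoc n).comp
        (by fun_prop : Measurable fun p : ((X → ℝ) × (Fin n → ℝ) × ℝ) × ℝ =>
          (p.1.2.1, p.1.1 (z n) + p.2))
      exact (by fun_prop : Measurable fun p : ((X → ℝ) × (Fin n → ℝ) × ℝ) × ℝ => p.1.1).prodMk
        (this.prodMk (by fun_prop))
    convert! h5.comp measurable_id h6 using 1
    ext ω : 1
    simp only [Function.comp, designObs_succ]

end Setting

end AdaptiveDesign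

/-! ### Posterior variances and information along a fixed design -/

section AdaptiveRegret

set_option linter.unusedSectionVars false

variable {Ω X : Type*} [MeasurableSpace Ω] [Fintype X] [DecidableEq X] [MeasurableSpace X]
  [MeasurableSingletonClass X] {P : Measure Ω} [IsProbabilityMeasure P]
  {m : EuclideanSpace ℝ X} {S : Matrix X X ℝ} {τ : ℕ → ℝ≥0} {σ : ℝ}
  {robs rhid : Ω → X → ℝ} {η : ℕ → Ω → ℝ} {xs xobs : Ω → X} {x : ℕ → Ω → X}

/-- The posterior variance after `n` observations at the locations `z 0, z 1, …`. -/
noncomputable def postVar (P : Measure Ω) (m : X → ℝ) (robs : Ω → X → ℝ) (η : ℕ → Ω → ℝ)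
    (z : ℕ → X) (n : ℕ) (a : X) : ℝ :=
  Var[fun ω => residual P m robs η z n ω a; P]

lemma postVar_nonneg (m : X → ℝ) (z : ℕ → X) (n : ℕ) (a : X) :
    0 ≤ postVar P m robs η z n a := variance_nonneg _ _

lemma postVar_congr (P : Measure Ω) (m : X → ℝ) (robs : Ω → X → ℝ) (η : ℕ → Ω → ℝ) {z z' : ℕ → X}
    {n : ℕ} (h : ∀ i < n, z i = z' i) : postVar P m robs η z n = postVar P m robs η z' n := by
  unfold postVar
  rw [residual_congr m robs η h]

namespace Setting

lemma memLp_residual (h : Setting P m S τ σ robs rhid η xs xobs x) (z : ℕ → X) (n : ℕ) (a : X) :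
    MemLp (fun ω => residual P m robs η z n ω a) 2 P :=
  (HasGaussianLaw.eval (h.residual_spec z n).1 a).memLp_two

lemma law_residual (h : Setting P m S τ σ robs rhid η xs xobs x) (z : ℕ → X) (n : ℕ) (a : X) :
    P.map (fun ω => residual P m robs η z n ω a) =
      gaussianReal 0 (postVar P m robs η z n a).toNNReal := by
  obtain ⟨hG, h0, -, -⟩ := h.residual_spec z n
  rw [(HasGaussianLaw.eval hG a).map_eq_gaussianReal, h0]
  rfl

/-- The sum of the information gains of the single rounds of a fixed design is bounded by the mutual
information between the rewards and all observations. -/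
lemma sum_ofReal_log_le_mutualInfo (h : Setting P m S τ σ robs rhid η xs xobs x) (hσ : 0 < σ)
    (z : ℕ → X) (N : ℕ) :
    ∑ n ∈ Finset.range N,
        ENNReal.ofReal (1 / 2 * Real.log (1 + (σ ^ 2)⁻¹ * postVar P m robs η z n (z n)))
      ≤ mutualInfo P robs (designObs robs η z N) := by
  induction N with
  | zero => simp
  | succ n ih =>
    have hrobs := h.measurable_robs
    have hY := measurable_designObs h.measurable_robs h.measurable_η z n
    have hη := h.measurable_η n
    obtain ⟨g, hg, hgr⟩ := exists_residual_eq_sub P m robs η z n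
    obtain ⟨hG, -, -, hind⟩ := h.residual_spec z n
    have hR := measurable_residual (P := P) (m := m) h.measurable_robs h.measurable_η z n
    have hu : Measurable fun ω => residual P m robs η z n ω (z n) := by fun_prop
    have hfst := comap_measurable (m := inferInstance)
      fun ω => (robs ω, rhid ω, hist robs η x n ω)
    have hnoise : IndepFun (fun ω => (robs ω, designObs robs η z n ω)) (η n) P :=
      (h.indepFun_noise z n ((measurable_fst.comp hfst).prodMk
        (measurable_comap_designObs z n))).comp
        (φ := fun p : ((X → ℝ) × (Fin n → ℝ)) × ℝ => p.1) (ψ := id) (by fun_prop) measurable_id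
    have hRη : IndepFun (fun ω => residual P m robs η z n ω (z n)) (η n) P :=
      (h.indepFun_noise z n (measurable_comap_residual (rhid := rhid) (x := x) P m z n)).comp
        (φ := fun p : (X → ℝ) × ℝ => p.1 (z n)) (ψ := id) (by fun_prop) measurable_id
    have hRY : IndepFun (fun ω => residual P m robs η z n ω (z n)) (designObs robs η z n) P :=
      hind.comp (φ := fun r : X → ℝ => r (z n)) (ψ := Prod.fst) (by fun_prop) measurable_fst
    have h1 : ENNReal.ofReal (1 / 2 * Real.log (1 + (σ ^ 2)⁻¹ * postVar P m robs η z n (z n))) ≤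
        mutualInfo P (fun ω => residual P m robs η z n ω (z n))
          (fun ω => residual P m robs η z n ω (z n) + η n ω) := by
      have h2 := ofReal_log_le_mutualInfo (q := σ ^ 2) hu hη hRη (h.law_residual z n (z n))
        (h.law_η n) (by positivity) (by
          push_cast
          exact pow_le_pow_left₀ (τ n).2 (h.τ_le n) 2)
      rwa [Real.coe_toNNReal _ (postVar_nonneg _ _ _ _)] at h2
    have hres : ∀ ω, residual P m robs η z n ω (z n) =
        robs ω (z n) - g (designObs robs η z n ω) (z n) := fun ω => hgr ω (z n)
    simp_rw [hres] at h1 hRY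
    have h3 := mutualInfo_add_le (φ := fun r : X → ℝ => r (z n)) (g := fun y => g y (z n))
      hrobs hY hη (by fun_prop) (by fun_prop) hnoise hRY
    have h4 := mutualInfo_comp_le (P := P) hrobs
      (measurable_designObs h.measurable_robs h.measurable_η z (n + 1))
      (by fun_prop : Measurable fun y : Fin (n + 1) → ℝ =>
        ((fun i : Fin n => y i.castSucc), y (Fin.last n)))
    rw [Finset.sum_range_succ]
    exact (add_le_add ih h1).trans (h3.trans h4)

end Setting

end AdaptiveRegret

/-! ### Expectations at randomly chosen actions -/

section Sampling

set_option linter.unusedSectionVars false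

variable {Ω X α β : Type*} [Fintype X]

lemma eval_eq_sum_indicator (F : Ω → X → ℝ) (y : Ω → X) (ω : Ω) :
    F ω (y ω) = ∑ a, (y ⁻¹' {a}).indicator (fun ω => F ω a) ω := by
  classical
  simp [Set.indicator_apply]

variable [MeasurableSpace Ω] [MeasurableSpace X] [MeasurableSingletonClass X] [MeasurableSpace α] [MeasurableSpace β] {P : Measure Ω}

lemma integrable_eval {F : Ω → X → ℝ} {y : Ω → X} (hy : Measurable y)
    (hF : ∀ a, Integrable (fun ω => F ω a) P) : Integrable (fun ω => F ω (y ω)) P := by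
  simp_rw [eval_eq_sum_indicator F y]
  exact integrable_finsetSum _ fun a _ => (hF a).indicator (hy (measurableSet_singleton a))

lemma integral_eval_eq_sum {F : Ω → X → ℝ} {y : Ω → X} (hy : Measurable y)
    (hF : ∀ a, Integrable (fun ω => F ω a) P) :
    ∫ ω, F ω (y ω) ∂P = ∑ a, ∫ ω, (y ⁻¹' {a}).indicator (fun ω => F ω a) ω ∂P := by
  simp_rw [eval_eq_sum_indicator F y]
  exact integral_finsetSum _ fun a _ => (hF a).indicator (hy (measurableSet_singleton a))

/-- An action sampled from the posterior given `H` yields the same expected reward as the optimal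
action, for rewards that are functions of `H`. -/
lemma SampledFromPosterior.integral_eval_eq [IsFiniteMeasure P] {z xs : Ω → X} {H : Ω → α}
    {G : Ω → β} (h : SampledFromPosterior P z xs H G) (hz : Measurable z) (hxs : Measurable xs)
    (hH : Measurable H) (hG : Measurable G)
    (hHG : MeasurableSpace.comap H inferInstance ≤ MeasurableSpace.comap G inferInstance)
    {F : Ω → X → ℝ} (hF : ∀ a, Measurable[MeasurableSpace.comap H inferInstance] fun ω => F ω a)
    (hFi : ∀ a, Integrable (fun ω => F ω a) P) :
    ∫ ω, F ω (z ω) ∂P = ∫ ω, F ω (xs ω) ∂P := by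
  rw [integral_eval_eq_sum hz hFi, integral_eval_eq_sum hxs hFi]
  refine Finset.sum_congr rfl fun a _ => ?_
  have hone : ∀ {y : Ω → X}, Measurable y →
      Integrable ((y ⁻¹' {a}).indicator fun _ => (1 : ℝ)) P := fun hy =>
    (integrable_const _).indicator (hy (measurableSet_singleton a))
  have hmul : ∀ y : Ω → X, (y ⁻¹' {a}).indicator (fun ω => F ω a) =
      (fun ω => F ω a) * (y ⁻¹' {a}).indicator fun _ => (1 : ℝ) := fun y => by
    ext ω
    by_cases hω : y ω = a <;> simp [hω]
  have hmi : ∀ {y : Ω → X}, Measurable y →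
      Integrable ((fun ω => F ω a) * (y ⁻¹' {a}).indicator fun _ => (1 : ℝ)) P := fun hy => by
    rw [← hmul]
    exact (hFi a).indicator (hy (measurableSet_singleton a))
  have h1 := condExp_mul_of_stronglyMeasurable_left (hF a).stronglyMeasurable (hmi hxs) (hone hxs)
  have h2 := condExp_mul_of_stronglyMeasurable_left ((hF a).mono hHG le_rfl).stronglyMeasurable
    (hmi hz) (hone hz)
  have h3 := integral_condExp hG.comap_le (μ := P)
    (f := (fun ω => F ω a) * (z ⁻¹' {a}).indicator fun _ => (1 : ℝ))
  have h4 := integral_condExp hH.comap_le (μ := P)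
    (f := (fun ω => F ω a) * (xs ⁻¹' {a}).indicator fun _ => (1 : ℝ))
  rw [hmul, hmul, ← h3, ← h4]
  refine integral_congr_ae (h2.trans (Filter.EventuallyEq.trans ?_ h1.symm))
  filter_upwards [h a] with ω hω
  simp only [Pi.mul_apply, hω]

lemma SampledFromPosterior.measureReal_eq [IsFiniteMeasure P] {z xs : Ω → X} {H : Ω → α}
    {G : Ω → β} (h : SampledFromPosterior P z xs H G) (hz : Measurable z) (hxs : Measurable xs)
    (hH : Measurable H) (hG : Measurable G) (a : X) :
    P.real (z ⁻¹' {a}) = P.real (xs ⁻¹' {a}) := by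
  have h1 := integral_condExp hG.comap_le (μ := P) (f := (z ⁻¹' {a}).indicator fun _ => (1 : ℝ))
  have h2 := integral_condExp hH.comap_le (μ := P) (f := (xs ⁻¹' {a}).indicator fun _ => (1 : ℝ))
  rw [integral_congr_ae (h a), h2] at h1
  exact (integral_indicator_one (hz (measurableSet_singleton a))).symm.trans
    (h1.symm.trans (integral_indicator_one (hxs (measurableSet_singleton a))))

lemma integral_indicator_of_indepFun [IsProbabilityMeasure P] {V : Ω → ℝ} {E : Set Ω}
    (hV : AEStronglyMeasurable V P) (hE : MeasurableSet E)
    (h : IndepFun V (E.indicator fun _ => (1 : ℝ)) P) :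
    ∫ ω, E.indicator V ω ∂P = P.real E * ∫ ω, V ω ∂P := by
  have h1 := h.integral_fun_mul_eq_mul_integral hV
    (measurable_const.indicator hE).aestronglyMeasurable
  have h2 : ∫ ω, E.indicator (fun _ => (1 : ℝ)) ω ∂P = P.real E := integral_indicator_one hE
  rw [h2, mul_comm] at h1
  rw [← h1]
  congr 1
  ext ω
  by_cases hω : ω ∈ E <;> simp [hω]

end Sampling

/-! ### From fixed designs to the played path -/

section AdaptiveRegret

set_option linter.unusedSectionVars false

variable {Ω X : Type*} [MeasurableSpace Ω] [Fintype X] [DecidableEq X] [MeasurableSpace X]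
  [MeasurableSingletonClass X] {P : Measure Ω} [IsProbabilityMeasure P]
  {m : EuclideanSpace ℝ X} {S : Matrix X X ℝ} {τ : ℕ → ℝ≥0} {σ : ℝ}
  {robs rhid : Ω → X → ℝ} {η : ℕ → Ω → ℝ} {xs xobs : Ω → X} {x : ℕ → Ω → X}

/-- Some infinite sequence that extends `p`. -/
noncomputable def extend {n : ℕ} [Nonempty X] (p : Fin n → X) (i : ℕ) : X :=
  if h : i < n then p ⟨i, h⟩ else Classical.arbitrary X

lemma extend_apply [Nonempty X] {n : ℕ} (p : Fin n → X) {i : ℕ} (h : i < n) :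
    extend p i = p ⟨i, h⟩ := dif_pos h

/-- At each outcome exactly one prefix of length n is the one played, and V does not see beyond it.
-/
lemma eq_sum_indicator_playedBefore [Nonempty X] {n : ℕ} {V : (ℕ → X) → Ω → ℝ}
    (hV : ∀ z z' : ℕ → X, (∀ i < n, z i = z' i) → V z = V z') (ω : Ω) :
    V (fun i => x i ω) ω = ∑ p : Fin n → X, (playedBefore x (extend p) n).indicator
      (V (extend p)) ω := by
  classical
  rw [Finset.sum_eq_single (fun i : Fin n => x i ω)]
  · have hmem : ω ∈ playedBefore x (extend fun i : Fin n => x i ω) n := fun i hi => by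
      rw [extend_apply _ hi]
    rw [Set.indicator_of_mem hmem, hV _ _ hmem]
  · intro p _ hp
    refine Set.indicator_of_notMem (fun hmem => hp ?_) _
    ext i
    rw [hmem i i.2, extend_apply p i.2]
  · simp

namespace Setting

/-- To integrate a quantity that depends on the past actions, it suffices to treat fixed designs,
provided that the quantity is independent of the event that the design is played. -/
lemma integral_adaptive_le (h : Setting P m S τ σ robs rhid η xs xobs x) [Nonempty X] {n : ℕ}
    {E : Set Ω} (hE : MeasurableSet E) {V : (ℕ → X) → Ω → ℝ}
    (hV : ∀ z z' : ℕ → X, (∀ i < n, z i = z' i) → V z = V z') (hVi : ∀ z, Integrable (V z) P)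
    (hind : ∀ z, IndepFun (V z) ((playedBefore x z n ∩ E).indicator fun _ => (1 : ℝ)) P) {c : ℝ}
    (hc : ∀ z, ∫ ω, V z ω ∂P ≤ c) :
    Integrable (fun ω => V (fun i => x i ω) ω) P ∧
      ∫ ω, E.indicator (fun ω => V (fun i => x i ω) ω) ω ∂P ≤ P.real E * c := by
  have hA := h.measurableSet_playedBefore
  have h1 : ∀ ω, E.indicator (fun ω => V (fun i => x i ω) ω) ω =
      ∑ p : Fin n → X, (playedBefore x (extend p) n ∩ E).indicator (V (extend p)) ω := by
    intro ω
    by_cases hω : ω ∈ E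
    · rw [Set.indicator_of_mem hω, eq_sum_indicator_playedBefore hV]
      refine Finset.sum_congr rfl fun p _ => ?_
      by_cases hp : ω ∈ playedBefore x (extend p) n <;> simp [hω, hp]
    · simp [hω]
  -- The prefixes partition E, so the fixed-design bounds are averaged with weights that add up to
  -- P(E).
  have h2 : P.real E = ∑ p : Fin n → X, P.real (playedBefore x (extend p) n ∩ E) := by
    rw [← integral_indicator_one hE]
    simp_rw [← integral_indicator_one ((hA _ n).inter hE)]
    rw [← integral_finsetSum _ fun p _ => (integrable_const _).indicator ((hA _ n).inter hE)]
    congr 1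
    ext ω
    have h3 := eq_sum_indicator_playedBefore (x := x) (n := n) (V := fun _ => E.indicator 1)
      (fun _ _ _ => rfl) ω
    rw [h3]
    simp_rw [Set.indicator_indicator]
  constructor
  · simp_rw [eq_sum_indicator_playedBefore hV]
    exact integrable_finsetSum _ fun p _ => (hVi _).indicator (hA _ n)
  · simp_rw [h1]
    rw [integral_finsetSum _ fun p _ => (hVi _).indicator ((hA _ n).inter hE), h2, Finset.sum_mul]
    refine Finset.sum_le_sum fun p _ => ?_
    rw [integral_indicator_of_indepFun (hVi _).aestronglyMeasurable ((hA _ n).inter hE) (hind _)]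
    exact mul_le_mul_of_nonneg_left (hc _) measureReal_nonneg

lemma integral_adaptive_eq (h : Setting P m S τ σ robs rhid η xs xobs x) [Nonempty X] {n : ℕ}
    {E : Set Ω} (hE : MeasurableSet E) {V : (ℕ → X) → Ω → ℝ}
    (hV : ∀ z z' : ℕ → X, (∀ i < n, z i = z' i) → V z = V z') (hVi : ∀ z, Integrable (V z) P)
    (hind : ∀ z, IndepFun (V z) ((playedBefore x z n ∩ E).indicator fun _ => (1 : ℝ)) P) {c : ℝ}
    (hc : ∀ z, ∫ ω, V z ω ∂P = c) :
    ∫ ω, E.indicator (fun ω => V (fun i => x i ω) ω) ω ∂P = P.real E * c := by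
  refine le_antisymm (h.integral_adaptive_le hE hV hVi hind fun z => (hc z).le).2 ?_
  have h1 := (h.integral_adaptive_le (V := fun z ω => - V z ω) (c := -c) hE
    (fun z z' hz => by rw [hV z z' hz]) (fun z => (hVi z).neg)
    (fun z => (hind z).comp measurable_neg measurable_id)
    (fun z => by rw [integral_neg, hc])).2
  have h2 : ∀ ω, E.indicator (fun ω => - V (fun i => x i ω) ω) ω =
      - E.indicator (fun ω => V (fun i => x i ω) ω) ω := fun ω => by
    by_cases hω : ω ∈ E <;> simp [hω]
  simp_rw [h2] at h1
  rw [integral_neg] at h1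
  linarith

/-- The residual of a fixed design is independent of the event that this design is played. -/
lemma indepFun_residual_choice (h : Setting P m S τ σ robs rhid η xs xobs x) (z : ℕ → X) (n : ℕ)
    (a b : X) :
    IndepFun (fun ω => residual P m robs η z n ω a)
      ((playedBefore x z n ∩ x n ⁻¹' {b}).indicator fun _ => (1 : ℝ)) P :=
  (h.indepFun_choice z n b measurable_id (fun ω => rfl)
    (measurable_comap_residual (rhid := rhid) (x := x) P m z n)
    ((measurable_comap_designObs z n).prodMk (measurable_comap_indicator_playedBefore z n))
    (h.residual_spec z n).2.2.2).comp (φ := fun r : X → ℝ => r a) (ψ := Prod.snd) (by fun_prop)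
      measurable_snd

lemma indepFun_hidden_choice (h : Setting P m S τ σ robs rhid η xs xobs x) (z : ℕ → X) (n : ℕ)
    (a b : X) :
    IndepFun (fun ω => rhid ω a)
      ((playedBefore x z n ∩ x n ⁻¹' {b}).indicator fun _ => (1 : ℝ)) P := by
  have hfst := comap_measurable (m := inferInstance)
    fun ω => (robs ω, rhid ω, hist robs η x n ω)
  exact (h.indepFun_choice z n b measurable_snd (fun ω => rfl)
    ((measurable_fst.comp measurable_snd).comp hfst)
    ((measurable_fst.comp hfst).prodMk ((measurable_comap_designObs z n).prodMk
      (measurable_comap_indicator_playedBefore z n)))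
    (h.indepFun_hidden z n)).comp (φ := fun r : X → ℝ => r a) (ψ := Prod.snd) (by fun_prop)
      measurable_snd

lemma integrable_robs (h : Setting P m S τ σ robs rhid η xs xobs x) (a : X) :
    Integrable (fun ω => robs ω a) P := by
  have h1 := (HasGaussianLaw.eval h.hasGaussianLaw_residual_zero a).integrable.add
    (integrable_const (m a))
  exact h1.congr (.of_forall fun ω => by simp)

/-- `x n` is independent of the hidden rewards and has the unconditional law of `xs`. The right-hand
side is common with `integral_hidden_xobs`, so hidden rewards cancel when the two actions are
compared. -/
lemma integral_hidden_action (h : Setting P m S τ σ robs rhid η xs xobs x) [Nonempty X] (n : ℕ) :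
    ∫ ω, rhid ω (x n ω) ∂P = ∑ a, P.real (xs ⁻¹' {a}) * ∫ ω, rhid ω a ∂P := by
  rw [integral_eval_eq_sum (h.measurable_x n) h.integrable_rhid]
  refine Finset.sum_congr rfl fun a _ => ?_
  rw [← (h.sampled_x n).measureReal_eq (h.measurable_x n) h.measurable_xs (h.measurable_hist n)
    (h.measurable_history n) a]
  exact h.integral_adaptive_eq (n := n) (V := fun _ ω => rhid ω a)
    (h.measurable_x n (measurableSet_singleton a)) (fun _ _ _ => rfl)
    (fun _ => h.integrable_rhid a) (fun z => h.indepFun_hidden_choice z n a a) (fun _ => rfl)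

lemma integral_hidden_xobs (h : Setting P m S τ σ robs rhid η xs xobs x) :
    ∫ ω, rhid ω (xobs ω) ∂P = ∑ a, P.real (xs ⁻¹' {a}) * ∫ ω, rhid ω a ∂P := by
  have hG : Measurable fun ω => (robs ω, rhid ω) := h.measurable_robs.prodMk h.measurable_rhid
  rw [integral_eval_eq_sum h.measurable_xobs h.integrable_rhid]
  refine Finset.sum_congr rfl fun a _ => ?_
  have hE := h.measurable_xobs (measurableSet_singleton a)
  rw [← h.sampled_xobs.measureReal_eq h.measurable_xobs h.measurable_xs h.measurable_robs hG a]
  refine integral_indicator_of_indepFun (h.integrable_rhid a).aestronglyMeasurable hE ?_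
  have hfst := comap_measurable (m := inferInstance) fun ω => (robs ω, rhid ω)
  have h1 := IndepFun.prodMk_indicator hG (measurable_snd.comp hfst) (measurable_fst.comp hfst) hE
    stronglyMeasurable_condExp.measurable (h.sampled_xobs a) h.indep_rhid.symm
  exact h1.comp (φ := fun r : X → ℝ => r a) (ψ := Prod.snd) (by fun_prop) measurable_snd

/-- Given `robs`, the actions `xobs` and `xs` have the same conditional law. -/
lemma integral_robs_xobs (h : Setting P m S τ σ robs rhid η xs xobs x) :
    ∫ ω, robs ω (xobs ω) ∂P = ∫ ω, robs ω (xs ω) ∂P := by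
  have hfst := comap_measurable (m := inferInstance) fun ω => (robs ω, rhid ω)
  exact h.sampled_xobs.integral_eval_eq h.measurable_xobs h.measurable_xs h.measurable_robs
    (h.measurable_robs.prodMk h.measurable_rhid) (measurable_fst.comp hfst).comap_le
    (fun a => (measurable_pi_apply a).comp (comap_measurable robs)) h.integrable_robs

end Setting

end AdaptiveRegret

/-! ### Regret of one round and of all rounds -/

section RegretBound

set_option linter.unusedSectionVars false

variable {Ω X : Type*} [MeasurableSpace Ω] [Fintype X] [DecidableEq X] [MeasurableSpace X]
  [MeasurableSingletonClass X] {P : Measure Ω} [IsProbabilityMeasure P]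
  {m : EuclideanSpace ℝ X} {S : Matrix X X ℝ} {τ : ℕ → ℝ≥0} {σ : ℝ}
  {robs rhid : Ω → X → ℝ} {η : ℕ → Ω → ℝ} {xs xobs : Ω → X} {x : ℕ → Ω → X}

namespace Setting

/-- The history contains both the played prefix and the observations, which is all the prediction
uses. This is what lets Thompson sampling exchange `x n` and `xs` in it. -/
lemma measurable_comap_prediction [Nonempty X] (P : Measure Ω) (m : X → ℝ) (n : ℕ) (a : X) :
    Measurable[MeasurableSpace.comap (hist robs η x n) inferInstance]
      fun ω => robs ω a - residual P m robs η (fun i => x i ω) n ω a := by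
  choose g hg hgr using fun z => exists_residual_eq_sub P m robs η z n
  have h1 : Measurable fun p : (Fin n → ℝ) × (Fin n → X) => g (extend p.2) p.1 a :=
    measurable_from_prod_countable_left fun p => (measurable_pi_apply a).comp (hg (extend p))
  have h2 : Measurable fun H : Fin n → X × ℝ =>
      g (extend fun i => (H i).1) (fun i => (H i).2) a :=
    h1.comp (by fun_prop : Measurable fun H : Fin n → X × ℝ =>
      ((fun i => (H i).2), fun i => (H i).1))
  convert! h2.comp (comap_measurable (hist robs η x n)) using 1
  ext ω
  have hpre : ∀ i < n, x i ω = extend (fun i : Fin n => x i ω) i := fun i hi => by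
    rw [extend_apply _ hi]
  have hobs : designObs robs η (extend fun i : Fin n => x i ω) n ω =
      fun i => (hist robs η x n ω i).2 := by
    ext i
    simp only [designObs, hist, obs]
    rw [← hpre i i.2]
  rw [residual_congr m robs η hpre, hgr, hobs, sub_sub_cancel]
  rfl

lemma measurable_comap_postVar [Nonempty X] (P : Measure Ω) (m : X → ℝ) (n : ℕ) (a : X) :
    Measurable[MeasurableSpace.comap (hist robs η x n) inferInstance]
      fun ω => postVar P m robs η (fun i => x i ω) n a := by
  have h1 : Measurable fun p : Fin n → X => postVar P m robs η (extend p) n a :=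
    measurable_of_countable _
  have h2 : Measurable fun H : Fin n → X × ℝ => postVar P m robs η (extend fun i => (H i).1) n a :=
    h1.comp (by fun_prop : Measurable fun (H : Fin n → X × ℝ) i => (H i).1)
  convert! h2.comp (comap_measurable (hist robs η x n)) using 1
  ext ω
  have hpre : ∀ i < n, x i ω = extend (fun i : Fin n => x i ω) i := fun i hi => by
    rw [extend_apply _ hi]
  rw [postVar_congr P m robs η hpre]
  rfl

lemma postVar_le_one (h : Setting P m S τ σ robs rhid η xs xobs x) (z : ℕ → X) (n : ℕ) (a : X) :
    postVar P m robs η z n a ≤ 1 := (h.residual_spec z n).2.2.1 a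

lemma integrable_postVar (h : Setting P m S τ σ robs rhid η xs xobs x) [Nonempty X] (n : ℕ)
    (a : X) : Integrable (fun ω => postVar P m robs η (fun i => x i ω) n a) P := by
  refine .of_bound ((measurable_comap_postVar P m n a).mono (h.measurable_hist n).comap_le
    le_rfl).aestronglyMeasurable 1 (.of_forall fun ω => ?_)
  rw [Real.norm_of_nonneg (postVar_nonneg _ _ _ _)]
  exact h.postVar_le_one _ _ _

lemma residual_family_congr (P : Measure Ω) (m : X → ℝ) (robs : Ω → X → ℝ) (η : ℕ → Ω → ℝ)
    (n : ℕ) (a : X) (z z' : ℕ → X) (hz : ∀ i < n, z i = z' i) :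
    (fun ω => residual P m robs η z n ω a) = fun ω => residual P m robs η z' n ω a := by
  rw [residual_congr m robs η hz]

lemma integrable_adaptive_residual (h : Setting P m S τ σ robs rhid η xs xobs x) [Nonempty X]
    (n : ℕ) (a : X) :
    Integrable (fun ω => residual P m robs η (fun i => x i ω) n ω a) P :=
  (h.integral_adaptive_le (n := n) (V := fun z ω => residual P m robs η z n ω a)
    (h.measurable_x n (measurableSet_singleton a))
    (residual_family_congr P m robs η n a)
    (fun z => (h.memLp_residual z n a).integrable (by norm_num))
    (fun z => h.indepFun_residual_choice z n a a)
    (fun z => ((h.residual_spec z n).2.1 a).le)).1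

/-- The one-round regret with respect to the observable reward is the expected residual at the
optimal action. -/
lemma integral_robs_sub (h : Setting P m S τ σ robs rhid η xs xobs x) [Nonempty X] (n : ℕ) :
    ∫ ω, robs ω (xs ω) ∂P - ∫ ω, robs ω (x n ω) ∂P =
      ∫ ω, residual P m robs η (fun i => x i ω) n ω (xs ω) ∂P := by
  set D : Ω → X → ℝ := fun ω a => residual P m robs η (fun i => x i ω) n ω a with hD
  have hDi : ∀ a, Integrable (fun ω => D ω a) P := h.integrable_adaptive_residual n
  have hMi : ∀ a, Integrable (fun ω => robs ω a - D ω a) P := fun a =>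
    (h.integrable_robs a).sub (hDi a)
  have h1 : ∫ ω, D ω (x n ω) ∂P = 0 := by
    rw [integral_eval_eq_sum (h.measurable_x n) hDi]
    refine Finset.sum_eq_zero fun a _ => ?_
    rw [h.integral_adaptive_eq (n := n) (V := fun z ω => residual P m robs η z n ω a)
      (h.measurable_x n (measurableSet_singleton a))
      (residual_family_congr P m robs η n a)
      (fun z => (h.memLp_residual z n a).integrable (by norm_num))
      (fun z => h.indepFun_residual_choice z n a a)
      (fun z => (h.residual_spec z n).2.1 a), mul_zero]
  have h2 : ∫ ω, (robs ω (x n ω) - D ω (x n ω)) ∂P = ∫ ω, (robs ω (xs ω) - D ω (xs ω)) ∂P :=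
    (h.sampled_x n).integral_eval_eq (F := fun ω a => robs ω a - D ω a) (h.measurable_x n)
      h.measurable_xs (h.measurable_hist n) (h.measurable_history n)
      (comap_hist_le_comap_history n) (measurable_comap_prediction P m n) hMi
  rw [integral_sub (integrable_eval (h.measurable_x n) h.integrable_robs)
    (integrable_eval (h.measurable_x n) hDi), integral_sub
    (integrable_eval h.measurable_xs h.integrable_robs)
    (integrable_eval h.measurable_xs hDi), h1] at h2
  linarith

lemma integral_postVar_eq (h : Setting P m S τ σ robs rhid η xs xobs x) [Nonempty X] (n : ℕ) :
    ∫ ω, postVar P m robs η (fun i => x i ω) n (x n ω) ∂P =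
      ∫ ω, postVar P m robs η (fun i => x i ω) n (xs ω) ∂P :=
  (h.sampled_x n).integral_eval_eq (F := fun ω a => postVar P m robs η (fun i => x i ω) n a)
    (h.measurable_x n) h.measurable_xs (h.measurable_hist n) (h.measurable_history n)
    (comap_hist_le_comap_history n) (measurable_comap_postVar P m n) (h.integrable_postVar n)

/-- Covers the actions of zero posterior variance, where D²/V is 0 by convention and controls
nothing. -/
lemma ae_residual_eq_zero (h : Setting P m S τ σ robs rhid η xs xobs x) [Nonempty X] (n : ℕ) :
    ∀ᵐ ω ∂P, ∀ a, postVar P m robs η (fun i => x i ω) n a = 0 →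
      residual P m robs η (fun i => x i ω) n ω a = 0 := by
  have h1 : ∀ᵐ ω ∂P, ∀ (p : Fin n → X) (a : X), postVar P m robs η (extend p) n a = 0 →
      residual P m robs η (extend p) n ω a = 0 := by
    rw [ae_all_iff]
    intro p
    rw [ae_all_iff]
    intro a
    by_cases hv : postVar P m robs η (extend p) n a = 0
    · filter_upwards [ae_eq_integral_of_variance_eq_zero (h.memLp_residual (extend p) n a) hv]
        with ω hω _
      rw [hω, (h.residual_spec (extend p) n).2.1 a]
    · exact .of_forall fun ω h0 => absurd h0 hv
  filter_upwards [h1] with ω hω a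
  have hpre : ∀ i < n, x i ω = extend (fun i : Fin n => x i ω) i := fun i hi => by
    rw [extend_apply _ hi]
  rw [postVar_congr P m robs η hpre, residual_congr m robs η hpre]
  exact hω _ a

/-- The expected residual at the optimal action, up to the choice of the weight `c`. -/
lemma integral_residual_le (h : Setting P m S τ σ robs rhid η xs xobs x) [Nonempty X] (n : ℕ)
    {c : ℝ} (hc : 0 < c) :
    ∫ ω, residual P m robs η (fun i => x i ω) n ω (xs ω) ∂P ≤
      (c * ∫ ω, postVar P m robs η (fun i => x i ω) n (x n ω) ∂P +
        (2 * Real.log (2 * Fintype.card X) + 2) / c) / 2 := by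
  have hN : (1 : ℝ) ≤ Fintype.card X := by exact_mod_cast Fintype.card_pos
  -- Chosen so that the |X| expected excesses, each at most 4 exp(−A/2), add up to at most 2.
  set A : ℝ := 2 * Real.log (2 * Fintype.card X) with hA
  have hA0 : 0 ≤ A := by
    have := Real.log_nonneg (by linarith : (1 : ℝ) ≤ 2 * Fintype.card X)
    positivity
  set D : Ω → X → ℝ := fun ω a => residual P m robs η (fun i => x i ω) n ω a with hD
  set V : Ω → X → ℝ := fun ω a => postVar P m robs η (fun i => x i ω) n a with hV
  have hDi : ∀ a, Integrable (fun ω => D ω a) P := h.integrable_adaptive_residual n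
  have hVi : ∀ a, Integrable (fun ω => V ω a) P := h.integrable_postVar n
  have hexc : ∀ a, Integrable (fun ω => max (D ω a ^ 2 / V ω a - A) 0) P ∧
      ∫ ω, max (D ω a ^ 2 / V ω a - A) 0 ∂P ≤ 4 * Real.exp (-A / 2) := by
    intro a
    have h1 := h.integral_adaptive_le (n := n) (E := Set.univ) (c := 4 * Real.exp (-A / 2))
      (V := fun z ω => max (residual P m robs η z n ω a ^ 2 / postVar P m robs η z n a - A) 0)
      MeasurableSet.univ
      (fun z z' hz => by rw [residual_congr m robs η hz, postVar_congr P m robs η hz])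
      (fun z => integrable_max_sq_div_sub (h.memLp_residual z n a) _ _)
      (fun z => by
        rw [Set.inter_univ]
        exact (h.residual_spec z n).2.2.2.comp
          (φ := fun r : X → ℝ => max (r a ^ 2 / postVar P m robs η z n a - A) 0) (ψ := Prod.snd)
          (by fun_prop) measurable_snd)
      (fun z => by
        have h2 := integral_max_sq_div_sub_le ((measurable_pi_apply a).comp
          (measurable_residual (P := P) (m := m) h.measurable_robs h.measurable_η z n))
          (h.law_residual z n a) hA0
        rwa [Real.coe_toNNReal _ (postVar_nonneg _ _ _ _)] at h2)
    simpa using h1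
  -- Summing the excesses over all actions makes D² ≤ V·Q hold at every action at once, in
  -- particular at `xs`, however it depends on D.
  set Q : Ω → ℝ := fun ω => A + ∑ a, max (D ω a ^ 2 / V ω a - A) 0 with hQ
  have hsumi : Integrable (fun ω => ∑ a, max (D ω a ^ 2 / V ω a - A) 0) P :=
    integrable_finsetSum _ fun a _ => (hexc a).1
  have hQi : Integrable Q P := (integrable_const A).add hsumi
  have hQle : ∫ ω, Q ω ∂P ≤ A + 2 := by
    simp only [hQ]
    rw [integral_add (integrable_const A) hsumi, integral_finsetSum _ fun a _ => (hexc a).1]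
    have h1 : ∑ a : X, ∫ ω, max (D ω a ^ 2 / V ω a - A) 0 ∂P ≤
        ∑ _a : X, 4 * Real.exp (-A / 2) := Finset.sum_le_sum fun a _ => (hexc a).2
    have h2 : Real.exp (-A / 2) = (2 * (Fintype.card X : ℝ))⁻¹ := by
      rw [hA, show -(2 * Real.log (2 * (Fintype.card X : ℝ))) / 2 =
        -Real.log (2 * (Fintype.card X : ℝ)) by ring, Real.exp_neg, Real.exp_log (by positivity)]
    rw [Finset.sum_const, Finset.card_univ, nsmul_eq_mul, h2,
      show (Fintype.card X : ℝ) * (4 * (2 * (Fintype.card X : ℝ))⁻¹) = 2 by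
        field_simp; norm_num] at h1
    simpa using h1
  have hpt : ∀ᵐ ω ∂P, D ω (xs ω) ≤ (c * V ω (xs ω) + Q ω / c) / 2 := by
    filter_upwards [h.ae_residual_eq_zero n] with ω hω
    have hQ0 : 0 ≤ Q ω := by positivity
    have hV0 : 0 ≤ V ω (xs ω) := postVar_nonneg _ _ _ _
    have hDQ : D ω (xs ω) ^ 2 ≤ V ω (xs ω) * Q ω := by
      rcases hV0.eq_or_lt with h0 | h0
      · rw [hD] at *
        simp only at *
        rw [hω _ h0.symm, ← h0]
        simp
      · have h1 : D ω (xs ω) ^ 2 / V ω (xs ω) - A ≤ ∑ a, max (D ω a ^ 2 / V ω a - A) 0 :=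
          (le_max_left _ _).trans (Finset.single_le_sum
            (f := fun a => max (D ω a ^ 2 / V ω a - A) 0) (fun a _ => le_max_right _ _)
            (Finset.mem_univ (xs ω)))
        have h2 : D ω (xs ω) ^ 2 / V ω (xs ω) ≤ Q ω := by simp only [hQ]; linarith
        rwa [div_le_iff₀ h0, mul_comm] at h2
    have hge : 0 ≤ (c * V ω (xs ω) + Q ω / c) / 2 := by positivity
    refine le_of_abs_le (abs_le_of_sq_le_sq ?_ hge)
    -- Arithmetic–geometric mean inequality for c V and Q / c.
    have h3 : V ω (xs ω) * Q ω = (c * V ω (xs ω)) * (Q ω / c) := by field_simp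
    nlinarith [sq_nonneg (c * V ω (xs ω) - Q ω / c)]
  have hVxs : Integrable (fun ω => V ω (xs ω)) P := integrable_eval h.measurable_xs hVi
  calc ∫ ω, D ω (xs ω) ∂P ≤ ∫ ω, (c * V ω (xs ω) + Q ω / c) / 2 ∂P :=
        integral_mono_ae (integrable_eval h.measurable_xs hDi)
          (((hVxs.const_mul c).add (hQi.div_const c)).div_const 2) hpt
    _ = (c * ∫ ω, V ω (xs ω) ∂P + (∫ ω, Q ω ∂P) / c) / 2 := by
        rw [integral_div, integral_add (hVxs.const_mul c) (hQi.div_const c), integral_const_mul,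
          integral_div]
    _ ≤ _ := by
        rw [h.integral_postVar_eq n]
        gcongr

/-- The expected posterior variances at the chosen actions sum up to at most the maximum information
gain, up to a factor. -/
lemma sum_integral_postVar_le (h : Setting P m S τ σ robs rhid η xs xobs x) [Nonempty X]
    (hσ : 0 < σ) (T : ℕ) (hγ : maxInfoGain P robs η T ≠ ∞) :
    ∑ n ∈ Finset.range T, ∫ ω, postVar P m robs η (fun i => x i ω) n (x n ω) ∂P ≤
      Cσ σ * (maxInfoGain P robs η T).toReal := by
  have hpath : ∀ z : ℕ → X, ∑ n ∈ Finset.range T, postVar P m robs η z n (z n) ≤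
      Cσ σ * (maxInfoGain P robs η T).toReal := by
    intro z
    have h1 : mutualInfo P robs (designObs robs η z T) ≤ maxInfoGain P robs η T :=
      le_iSup (fun z : Fin T → X => mutualInfo P robs
        (fun ω (i : Fin T) => robs ω (z i) + η i ω)) fun i => z i
    have hnn : ∀ n, 0 ≤ 1 / 2 * Real.log (1 + (σ ^ 2)⁻¹ * postVar P m robs η z n (z n)) :=
      fun n => mul_nonneg (by norm_num) (Real.log_nonneg (by
        have := postVar_nonneg (P := P) (robs := robs) (η := η) m z n (z n)
        have : 0 ≤ (σ ^ 2)⁻¹ * postVar P m robs η z n (z n) := by positivity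
        linarith))
    have h2 := (h.sum_ofReal_log_le_mutualInfo hσ z T).trans h1
    rw [← ENNReal.ofReal_sum_of_nonneg fun n _ => hnn n, ENNReal.ofReal_le_iff_le_toReal hγ] at h2
    calc _ ≤ ∑ n ∈ Finset.range T,
          Cσ σ * (1 / 2 * Real.log (1 + (σ ^ 2)⁻¹ * postVar P m robs η z n (z n))) :=
          Finset.sum_le_sum fun n _ =>
            le_Cσ_mul_log hσ (postVar_nonneg _ _ _ _) (h.postVar_le_one _ _ _)
      _ ≤ _ := by
          rw [← Finset.mul_sum]
          exact mul_le_mul_of_nonneg_left h2 (Cσ_pos hσ).le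
  have hi : ∀ n, Integrable (fun ω => postVar P m robs η (fun i => x i ω) n (x n ω)) P := fun n =>
    integrable_eval (h.measurable_x n) (h.integrable_postVar n)
  rw [← integral_finsetSum _ fun n _ => hi n]
  calc _ ≤ ∫ _, Cσ σ * (maxInfoGain P robs η T).toReal ∂P :=
        integral_mono (integrable_finsetSum _ fun n _ => hi n) (integrable_const _)
          -- The bound holds for every deterministic sequence, so it may be evaluated at the random
          -- one.
          fun ω => hpath fun i => x i ω
    _ = _ := by simp

lemma integral_reward_sub (h : Setting P m S τ σ robs rhid η xs xobs x) [Nonempty X] (n : ℕ) :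
    ∫ ω, ((robs ω (xs ω) + rhid ω (xs ω)) - (robs ω (x n ω) + rhid ω (x n ω))) ∂P =
      ∫ ω, ((robs ω (xs ω) + rhid ω (xs ω)) - (robs ω (xobs ω) + rhid ω (xobs ω))) ∂P +
        ∫ ω, residual P m robs η (fun i => x i ω) n ω (xs ω) ∂P := by
  have hi : ∀ {y : Ω → X}, Measurable y → Integrable (fun ω => robs ω (y ω)) P := fun hy =>
    integrable_eval hy h.integrable_robs
  have hi' : ∀ {y : Ω → X}, Measurable y → Integrable (fun ω => rhid ω (y ω)) P := fun hy =>
    integrable_eval hy h.integrable_rhid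
  have hadd : ∀ {y : Ω → X}, Measurable y → Integrable (fun ω => robs ω (y ω) + rhid ω (y ω)) P :=
    fun hy => (hi hy).add (hi' hy)
  have hxs := h.measurable_xs
  have hxo := h.measurable_xobs
  have hxn := h.measurable_x n
  rw [integral_sub (hadd hxs) (hadd hxn), integral_sub (hadd hxs) (hadd hxo),
    integral_add (hi hxs) (hi' hxs), integral_add (hi hxn) (hi' hxn),
    integral_add (hi hxo) (hi' hxo), ← h.integral_robs_sub n, h.integral_hidden_action n,
    h.integral_hidden_xobs, h.integral_robs_xobs]
  ring

end Setting

/-- Optimises over c through the discriminant of a c² − 2 y c + b ≥ 0, which needs no separate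
treatment of a = 0 or b = 0. -/
lemma sq_le_mul_of_forall_le {y a b : ℝ} (hy : 0 ≤ y)
    (h : ∀ c : ℝ, 0 < c → y ≤ (c * a + b / c) / 2) (ha : 0 ≤ a) (hb : 0 ≤ b) :
    y ^ 2 ≤ a * b := by
  have h1 : ∀ c : ℝ, 0 ≤ a * (c * c) + (-2 * y) * c + b := by
    intro c
    rcases le_or_gt c 0 with hc | hc
    · nlinarith [mul_nonneg ha (mul_self_nonneg c), mul_nonneg hy (neg_nonneg.2 hc)]
    · have h2 := mul_le_mul_of_nonneg_right (h c hc) hc.le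
      have h3 : (c * a + b / c) / 2 * c = (a * (c * c) + b) / 2 := by field_simp
      rw [h3] at h2
      nlinarith
  have h2 := discrim_le_zero h1
  rw [discrim] at h2
  nlinarith

/-- The cumulative regret with respect to the observable reward. -/
lemma Setting.sum_integral_residual_le (h : Setting P m S τ σ robs rhid η xs xobs x) [Nonempty X]
    (hσ : 0 < σ) (T : ℕ) :
    ((∑ n ∈ Finset.range T,
        ∫ ω, residual P m robs η (fun i => x i ω) n ω (xs ω) ∂P : ℝ) : EReal) ≤
      (betaConst (Fintype.card X) : EReal) * (((ENNReal.ofReal (Cσ σ) * (T : ℝ≥0∞) *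
        maxInfoGain P robs η T) ^ (1 / 2 : ℝ) : ℝ≥0∞) : EReal) := by
  set D : ℕ → ℝ := fun n => ∫ ω, residual P m robs η (fun i => x i ω) n ω (xs ω) ∂P with hD
  set γ := maxInfoGain P robs η T with hγ
  set B : ℝ := 2 * Real.log (2 * Fintype.card X) + 2 with hB
  have hN : (1 : ℝ) ≤ Fintype.card X := by exact_mod_cast Fintype.card_pos
  have hB0 : 0 ≤ B := by
    have := Real.log_nonneg (by linarith : (1 : ℝ) ≤ 2 * Fintype.card X)
    positivity
  -- The argument yields the factor √B; the summand 1 in `betaConst` is slack.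
  have hβ : √B ≤ betaConst (Fintype.card X) := by
    rw [betaConst]
    linarith
  have hβ0 : 0 < betaConst (Fintype.card X) := by
    rw [betaConst]
    positivity
  rcases eq_or_ne (ENNReal.ofReal (Cσ σ) * (T : ℝ≥0∞) * γ) ∞ with htop | htop
  · rw [htop, ENNReal.top_rpow_of_pos (by norm_num), EReal.coe_ennreal_top,
      EReal.coe_mul_top_of_pos hβ0]
    exact le_top
  set K := (ENNReal.ofReal (Cσ σ) * (T : ℝ≥0∞) * γ) with hK
  have hKsqrt : ((K ^ (1 / 2 : ℝ) : ℝ≥0∞) : EReal) = ((√K.toReal : ℝ) : EReal) := by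
    rw [← EReal.coe_ennreal_toReal (by finiteness), ← ENNReal.toReal_rpow, Real.sqrt_eq_rpow]
  rw [hKsqrt, ← EReal.coe_mul, EReal.coe_le_coe_iff]
  set W := ∑ n ∈ Finset.range T, ∫ ω, postVar P m robs η (fun i => x i ω) n (x n ω) ∂P with hW
  have hW0 : 0 ≤ W := Finset.sum_nonneg fun n _ => integral_nonneg fun ω => postVar_nonneg _ _ _ _
  have hWK : W * T ≤ K.toReal := by
    -- Finiteness of the product forces γ to be finite only for T > 0, since 0 · ∞ = 0.
    rcases Nat.eq_zero_or_pos T with rfl | hT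
    · simp
    have hγtop : γ ≠ ∞ := by
      rintro h0
      refine htop ?_
      rw [hK, h0]
      refine ENNReal.mul_top (mul_ne_zero ?_ (by simpa using hT.ne'))
      simpa using Cσ_pos hσ
    have h1 := h.sum_integral_postVar_le hσ T hγtop
    rw [hK, ENNReal.toReal_mul, ENNReal.toReal_mul, ENNReal.toReal_ofReal (Cσ_pos hσ).le,
      ENNReal.toReal_natCast]
    calc W * T ≤ Cσ σ * γ.toReal * T := mul_le_mul_of_nonneg_right h1 (Nat.cast_nonneg T)
      _ = _ := by ring
  -- The same c serves all rounds, so optimising after summation amounts to Cauchy–Schwarz over the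
  -- rounds.
  have hsum : ∀ c : ℝ, 0 < c → ∑ n ∈ Finset.range T, D n ≤ (c * W + T * B / c) / 2 := by
    intro c hc
    refine (Finset.sum_le_sum fun n _ => h.integral_residual_le n hc).trans_eq ?_
    rw [← Finset.sum_div, Finset.sum_add_distrib, ← Finset.mul_sum, Finset.sum_const,
      Finset.card_range, nsmul_eq_mul, mul_div_assoc]
  have hle : ∑ n ∈ Finset.range T, D n ≤ √B * √K.toReal := by
    rcases le_or_gt (∑ n ∈ Finset.range T, D n) 0 with h0 | h0
    · exact h0.trans (by positivity)
    · have h1 := sq_le_mul_of_forall_le h0.le hsum hW0 (by positivity)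
      rw [← Real.sqrt_mul hB0]
      refine Real.le_sqrt_of_sq_le (h1.trans ?_)
      nlinarith [mul_le_mul_of_nonneg_left hWK hB0]
  exact hle.trans (mul_le_mul_of_nonneg_right hβ (Real.sqrt_nonneg _))

end RegretBound

end HiddenRewardBandit

theorem corollary1 {Ω X : Type*} [MeasurableSpace Ω] [Fintype X] [DecidableEq X]
    [MeasurableSpace X] [MeasurableSingletonClass X]
    (P : Measure Ω) [IsProbabilityMeasure P]
    (m : EuclideanSpace ℝ X) (S : Matrix X X ℝ) (τ : ℕ → ℝ≥0) (σ : ℝ) (hσ : 0 < σ)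
    (robs rhid : Ω → X → ℝ) (η : ℕ → Ω → ℝ) (xs xobs : Ω → X) (x : ℕ → Ω → X)
    (h : HiddenRewardBandit.Setting P m S τ σ robs rhid η xs xobs x)
    (r : Ω → X → ℝ) (hr : ∀ ω a, r ω a = robs ω a + rhid ω a)
    (Δ : ℝ) (hΔ : Δ = ∫ ω, (r ω (xs ω) - r ω (xobs ω)) ∂P) (T : ℕ) :
    Integrable (fun ω => r ω (xs ω) - r ω (xobs ω)) P ∧
    Integrable (fun ω => ∑ n ∈ Finset.range T, (r ω (xs ω) - r ω (x n ω))) P ∧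
    ((∫ ω, ∑ n ∈ Finset.range T, (r ω (xs ω) - r ω (x n ω)) ∂P : ℝ) : EReal) ≤
      (HiddenRewardBandit.betaConst (Fintype.card X) : EReal) *
          (((ENNReal.ofReal (HiddenRewardBandit.Cσ σ) * (T : ℝ≥0∞) *
            HiddenRewardBandit.maxInfoGain P robs η T) ^ (1 / 2 : ℝ) : ℝ≥0∞) : EReal)
        + (((T : ℝ) * Δ : ℝ) : EReal) := by
  obtain ⟨ω₀⟩ : Nonempty Ω := nonempty_of_isProbabilityMeasure P
  have : Nonempty X := ⟨xs ω₀⟩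
  have hri : ∀ a, Integrable (fun ω => r ω a) P := fun a => by
    simp_rw [hr]
    exact (h.integrable_robs a).add (h.integrable_rhid a)
  have hsub : ∀ {y : Ω → X}, Measurable y → Integrable (fun ω => r ω (xs ω) - r ω (y ω)) P :=
    fun hy => (HiddenRewardBandit.integrable_eval h.measurable_xs hri).sub (HiddenRewardBandit.integrable_eval hy hri)
  refine ⟨hsub h.measurable_xobs, integrable_finsetSum _ fun n _ => hsub (h.measurable_x n), ?_⟩
  rw [integral_finsetSum _ fun n _ => hsub (h.measurable_x n)]
  set D : ℕ → ℝ := fun n => ∫ ω, HiddenRewardBandit.residual P m robs η (fun i => x i ω) n ω (xs ω) ∂P with hD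
  have hreg : ∑ n ∈ Finset.range T, ∫ ω, (r ω (xs ω) - r ω (x n ω)) ∂P =
      ∑ n ∈ Finset.range T, D n + T * Δ := by
    have h1 : ∀ n, ∫ ω, (r ω (xs ω) - r ω (x n ω)) ∂P = D n + Δ := fun n => by
      rw [hΔ]
      simp_rw [hr]
      rw [h.integral_reward_sub n, add_comm]
    simp_rw [h1]
    simp [Finset.sum_add_distrib]
  rw [hreg, EReal.coe_add]
  exact add_le_add (h.sum_integral_residual_le hσ T) le_rfl
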